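/- Let $q$ be a prime power, let $b\ge 1$ and $1\le n\le q$ be integers, and let $\mathcal V=(\mathcal V_1,\dots,\mathcal V_n)$ be a $b$-local profile, i.e. a sequence of linear subspaces of $\mathbb F_q^b$. A matrix $A\in\mathbb F_q^{n\times b}$ satisfies $\mathcal V$ if its $i$-th row lies in $\mathcal V_i$ for every $i$; a code $\mathcal C\subseteq\mathbb F_q^n$ contains $A$ if every column of $A$ is in $\mathcal C$; and $\mathcal C$ contains $\mathcal V$ if it contains some matrix with pairwise distinct columns that satisfies $\mathcal V$. Let $\varepsilon>0$ and let $R$ be a real number such that $k=Rn$ is a non-negative integer and $$R\le \min_{\{0\}\ne U\le \mathbb F_q^b}\frac{\sum_{i=1}^n\bigl(\dim U-\dim(\mathcal V_i\cap U)\bigr)}{n\dim U}-\varepsilon .$$ Let $\mathcal C=\{(f(\alpha_1),\dots,f(\alpha_n)) : f\in\mathbb F_q[X],\ \deg f<k\}$, where $\alpha_1,\dots,\alpha_n$ are sampled independently and uniformly from $\mathbb F_q$. Assume that $q>kb$ and $\varepsilon n\ge 2b(b+1)$. Then, if $b\ge 2$, $$\Pr[\mathcal C\text{ contains }\mathcal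 V]\le\left(\frac{(4b)^{4b}\,k}{\varepsilon q}\right)^{\frac{\varepsilon n}{2b}} ,$$ and for every $b\ge 1$ the probability that $\mathcal C$ contains a nonzero matrix satisfying $\mathcal V$ is at most the same quantity. -/

import Mathlib

namespace RSProfile

/-- A `b`-local profile of length `n` over `F`: a sequence of `n` linear subspaces of `F ^ b`. -/
abbrev LocalProfile (F : Type*) [Field F] (n b : ℕ) := Fin n → Submodule F (Fin b → F)

/-- The matrix `A` satisfies the profile `V`: the `i`-th row of `A` lies in `V i` for every `i`. -/
def Satisfies {F : Type*} [Field F] {n b : ℕ}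
    (A : Matrix (Fin n) (Fin b) F) (V : LocalProfile F n b) : Prop :=
  ∀ i, A.row i ∈ V i

/-- The code `C` contains the matrix `A`: every column of `A` is a codeword of `C`. -/
def ContainsMatrix {F : Type*} {n b : ℕ}
    (C : Set (Fin n → F)) (A : Matrix (Fin n) (Fin b) F) : Prop :=
  ∀ j, A.col j ∈ C

/-- The code `C` contains the profile `V`: it contains some matrix with pairwise distinct columns
that satisfies `V`. -/
def ContainsProfile {F : Type*} [Field F] {n b : ℕ}
    (C : Set (Fin n → F)) (V : LocalProfile F n b) : Prop :=
  ∃ A : Matrix (Fin n) (Fin b) F,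
    Function.Injective A.col ∧ Satisfies A V ∧ ContainsMatrix C A

/-- The code `C` contains a nonzero matrix that satisfies the profile `V`. -/
def ContainsNonzero {F : Type*} [Field F] {n b : ℕ}
    (C : Set (Fin n → F)) (V : LocalProfile F n b) : Prop :=
  ∃ A : Matrix (Fin n) (Fin b) F, A ≠ 0 ∧ Satisfies A V ∧ ContainsMatrix C A

/-- The Reed–Solomon code with (possibly repeating) evaluation points `α 0, …, α (n - 1)`:
evaluations of the polynomials of degree less than `k`. -/
def rsCode {F : Type*} [Field F] {n : ℕ} (α : Fin n → F) (k : ℕ) : Set (Fin n → F) :=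
  {c | ∃ f : Polynomial F, f.degree < (k : WithBot ℕ) ∧ ∀ i, c i = f.eval (α i)}

/-- The minimum over the nonzero subspaces `U` of `F ^ b` of
`(∑ i, (dim U - dim (V i ∩ U))) / (dim U * n)`. For finite `F` and `0 < b` it is the infimum of a
finite nonempty family, hence a true minimum. -/
noncomputable def minRate {F : Type*} [Field F] {n b : ℕ} (V : LocalProfile F n b) : ℝ :=
  ⨅ U : {U : Submodule F (Fin b → F) // U ≠ ⊥},
    (∑ i, ((Module.finrank F U.1 : ℝ) - (Module.finrank F ↥(V i ⊓ U.1) : ℝ))) /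
      ((Module.finrank F U.1 : ℝ) * n)

/-- The probability of the event `E` when `α 0, …, α (n - 1)` are sampled independently and
uniformly from `F`, that is, when `α` is uniformly distributed on `F ^ n`. -/
noncomputable def pointsProb {F : Type*} [Field F] [Fintype F] {n : ℕ}
    (E : Set (Fin n → F)) : ℝ :=
  ((PMF.uniformOfFintype (Fin n → F)).toOuterMeasure E).toReal

end RSProfile

/-! A nonzero matrix in the code satisfying the profile is a nonzero vector `f` of `b` polynomials
of degree less than `k` with `f(α i) ∈ V i`. Writing `V i` as the kernel of a matrix `A i`, each
point imposes linear constraints on `f`. The points are revealed one by one.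

Let `W` be the space of polynomial vectors of degree less than `k + N` meeting the constraints
revealed so far. For every subspace `S` of `F(X)^b` one tracks `dim (W ∩ S)` against the total rank
on `S` of the constraints still to come (`Slack`). Initially the rate condition gives a margin of
`t` per dimension of `S`; it is stated over `F`, and passes to `F(X)` by specializing `S` at `0`,
which keeps its dimension. A generic point lowers `dim (W ∩ S)` by exactly the rank spent, as long
as `W ∩ S` spans `S`. Only nearly extremal `S` need this. A strictly convex term `b (dim S)²` makes
them a chain, so there are at most `b` of them, and each excludes only the roots of one minor. Hence
few values of a point are bad, and a bad value costs one unit of margin. If fewer than `t` points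
are bad, then at the end `W` meets the line of `f` in dimension less than `N`, whereas the multiples
`p • f` with `deg p ≤ N` give dimension `N + 1`.

So at least `t` points are bad, and a union bound over positions gives probability at most `C(n,t)
(D/q)^t`. The bound `D` on the number of bad values grows with `t`, so for large `ε n` a single run
is too weak. The profile is then relaxed to several profiles constraining disjoint coordinates
(`SlopeGE.exists_disjoint`), each of which forces its own `t` bad points. -/

namespace RSProfile

/-! ### Polynomial vectors in subspaces of `F(X)^b`, and specialization at `0`. -/

open Polynomial Module

variable {F : Type*} [Field F] {b : ℕ}

/-- The inclusion of polynomial vectors into vectors of rational functions. -/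
noncomputable def toRat (F : Type*) [Field F] (b : ℕ) :
    (Fin b → F[X]) →ₗ[F[X]] (Fin b → RatFunc F) :=
  (Algebra.linearMap F[X] (RatFunc F)).compLeft (Fin b)

@[simp] lemma toRat_apply (f : Fin b → F[X]) (i : Fin b) :
    toRat F b f i = algebraMap F[X] (RatFunc F) (f i) := rfl

lemma toRat_injective : Function.Injective (toRat F b) := fun f g h => by
  funext i
  exact IsFractionRing.injective F[X] (RatFunc F) (congrFun h i)

/-- The polynomial vectors in a subspace of `F(X) ^ b`. -/
noncomputable def polyPart (S : Submodule (RatFunc F) (Fin b → RatFunc F)) :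
    Submodule F[X] (Fin b → F[X]) :=
  (S.restrictScalars F[X]).comap (toRat F b)

@[simp] lemma mem_polyPart {S : Submodule (RatFunc F) (Fin b → RatFunc F)}
    {f : Fin b → F[X]} : f ∈ polyPart S ↔ toRat F b f ∈ S := Iff.rfl

/-- Coordinatewise evaluation of polynomial vectors. -/
noncomputable def evalVec (b : ℕ) (x : F) : (Fin b → F[X]) →ₗ[F] (Fin b → F) :=
  (Polynomial.leval x).compLeft (Fin b)

@[simp] lemma evalVec_apply (x : F) (f : Fin b → F[X]) (i : Fin b) :
    evalVec b x f i = (f i).eval x := rfl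

lemma evalVec_smul (x : F) (p : F[X]) (f : Fin b → F[X]) :
    evalVec b x (p • f) = p.eval x • evalVec b x f := by
  funext i; simp

lemma exists_smul_mem_polyPart (S : Submodule (RatFunc F) (Fin b → RatFunc F))
    {v : Fin b → RatFunc F} (hv : v ∈ S) :
    ∃ d : F[X], d ≠ 0 ∧ ∃ f ∈ polyPart S, toRat F b f = d • v := by
  obtain ⟨d, hd⟩ := IsLocalization.exist_integer_multiples_of_finite (nonZeroDivisors F[X]) v
  choose f hf using hd
  have hfv : toRat F b f = (d : F[X]) • v := by
    funext i; simpa using hf i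
  refine ⟨d, nonZeroDivisors.ne_zero d.2, f, ?_, hfv⟩
  rw [mem_polyPart, hfv, ← algebraMap_smul (RatFunc F) (d : F[X]) v]
  exact S.smul_mem _ hv

lemma exists_eq_X_smul {f : Fin b → F[X]} (hf : evalVec b 0 f = 0) :
    ∃ g : Fin b → F[X], f = (X : F[X]) • g := by
  have h : ∀ i, (X : F[X]) ∣ f i := fun i => by
    rw [X_dvd_iff, coeff_zero_eq_eval_zero]
    exact congrFun hf i
  choose g hg using h
  exact ⟨g, funext fun i => by simpa using hg i⟩

lemma mem_polyPart_of_smul {S : Submodule (RatFunc F) (Fin b → RatFunc F)} {p : F[X]}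
    (hp : p ≠ 0) {g : Fin b → F[X]} (h : p • g ∈ polyPart S) : g ∈ polyPart S := by
  rw [mem_polyPart, map_smul, ← algebraMap_smul (RatFunc F) p] at h
  have hp' : algebraMap F[X] (RatFunc F) p ≠ 0 := by
    simpa using hp
  rw [mem_polyPart]
  exact (S.smul_mem_iff hp').1 h

/-- The specialization at `0` of a subspace of `F(X) ^ b`. -/
noncomputable def specialize (S : Submodule (RatFunc F) (Fin b → RatFunc F)) :
    Submodule F (Fin b → F) :=
  ((polyPart S).restrictScalars F).map (evalVec b 0)

/-- Clearing denominators, an `F[X]`-basis of `polyPart S` is also an `F(X)`-basis of `S`. Its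
values at `0` stay independent because `polyPart S` is saturated: a relation at `0` gives a
combination divisible by `X`, whose quotient is again in `polyPart S`, so all coefficients are
divisible by `X`. -/
lemma finrank_specialize (S : Submodule (RatFunc F) (Fin b → RatFunc F)) :
    finrank F (specialize S) = finrank (RatFunc F) S := by
  obtain ⟨s, B⟩ := Submodule.basisOfPid (Pi.basisFun F[X] (Fin b)) (polyPart S)
  have hBmem : ∀ l, (B l : Fin b → F[X]) ∈ polyPart S := fun l => (B l).2
  -- the basis spans `S` over the rational functions
  have hli : LinearIndependent (RatFunc F) (fun l => toRat F b (B l)) := by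
    rw [← LinearIndependent.iff_fractionRing F[X] (RatFunc F)]
    have h1 : LinearIndependent F[X] (fun l => (B l : Fin b → F[X])) :=
      B.linearIndependent.map' (polyPart S).subtype (Submodule.ker_subtype _)
    exact h1.map' (toRat F b) (LinearMap.ker_eq_bot.2 toRat_injective)
  have hspan : Submodule.span (RatFunc F) (Set.range fun l => toRat F b (B l)) = S := by
    apply le_antisymm
    · rw [Submodule.span_le]
      rintro _ ⟨l, rfl⟩
      exact hBmem l
    · intro v hv
      obtain ⟨d, hd, f, hf, hfv⟩ := exists_smul_mem_polyPart S hv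
      have hd' : algebraMap F[X] (RatFunc F) d ≠ 0 := by simpa using hd
      rw [← algebraMap_smul (RatFunc F) d v] at hfv
      rw [← Submodule.smul_mem_iff _ hd', ← hfv]
      have hsum := congrArg (fun u : polyPart S => toRat F b u) (B.sum_repr ⟨f, hf⟩)
      simp only [Submodule.coe_sum, Submodule.coe_smul, map_sum, map_smul] at hsum
      rw [← hsum]
      refine Submodule.sum_mem _ fun l _ => ?_
      rw [← algebraMap_smul (RatFunc F)]
      exact Submodule.smul_mem _ _ (Submodule.subset_span ⟨l, rfl⟩)
  have hli0 : LinearIndependent F (fun l => evalVec b 0 (B l : Fin b → F[X])) := by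
    rw [Fintype.linearIndependent_iff]
    intro c hc l
    have h0 : evalVec b 0 (∑ l, C (c l) • (B l : Fin b → F[X])) = 0 := by
      simpa [map_sum, evalVec_smul] using hc
    obtain ⟨g, hg⟩ := exists_eq_X_smul h0
    have hmem : (∑ l, C (c l) • (B l : Fin b → F[X])) ∈ polyPart S :=
      Submodule.sum_mem _ fun l _ => Submodule.smul_mem _ _ (hBmem l)
    have hgm : g ∈ polyPart S := mem_polyPart_of_smul X_ne_zero (hg ▸ hmem)
    have heq : (∑ l, C (c l) • B l) = (X : F[X]) • (⟨g, hgm⟩ : polyPart S) := by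
      apply Subtype.ext
      simpa using hg
    have hr := congrArg (fun u => B.repr u l) heq
    simp only [map_sum, map_smul, Basis.repr_self, Finsupp.coe_finsetSum, Finset.sum_apply,
      Finsupp.smul_apply] at hr
    rw [Finset.sum_eq_single l (by intro j _ hj; simp [hj]) (by simp)] at hr
    have := congrArg (fun p => p.coeff 0) hr
    simpa using this
  have hspan0 : Submodule.span F (Set.range fun l => evalVec b 0 (B l : Fin b → F[X]))
      = specialize S := by
    apply le_antisymm
    · rw [Submodule.span_le]
      rintro _ ⟨l, rfl⟩
      exact ⟨_, hBmem l, rfl⟩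
    · rintro _ ⟨f, hf, rfl⟩
      have hsum := congrArg (fun u : polyPart S => evalVec b 0 (u : Fin b → F[X]))
        (B.sum_repr ⟨f, hf⟩)
      simp only [Submodule.coe_sum, Submodule.coe_smul, map_sum, evalVec_smul] at hsum
      rw [← hsum]
      exact Submodule.sum_mem _ fun l _ =>
        Submodule.smul_mem _ _ (Submodule.subset_span ⟨l, rfl⟩)
  rw [← hspan0, finrank_span_eq_card hli0, ← finrank_span_eq_card hli, hspan]

/-- The polynomial vectors whose coordinates have degree less than `d`. -/
noncomputable def degVec (F : Type*) [Field F] (b d : ℕ) : Submodule F (Fin b → F[X]) :=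
  Submodule.pi Set.univ fun _ => degreeLT F d

lemma mem_degVec {d : ℕ} {f : Fin b → F[X]} :
    f ∈ degVec F b d ↔ ∀ i, (f i).degree < d := by
  simp [degVec, mem_degreeLT]

instance (d : ℕ) : FiniteDimensional F (degVec F b d) := by
  have : Module.Finite F (degreeLT F d) := Module.Finite.equiv (degreeLTEquiv F d).symm
  have h : degVec F b d ≤ LinearMap.range ((degreeLT F d).subtype.compLeft (Fin b)) := by
    intro f hf
    exact ⟨fun i => ⟨f i, hf i trivial⟩, rfl⟩
  exact Submodule.finiteDimensional_of_le h

/-- The intersection of an `F`-space of polynomial vectors with a subspace of `F(X) ^ b`. -/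
noncomputable def inter (W : Submodule F (Fin b → F[X]))
    (S : Submodule (RatFunc F) (Fin b → RatFunc F)) : Submodule F (Fin b → F[X]) :=
  W ⊓ (polyPart S).restrictScalars F

lemma mem_inter {W : Submodule F (Fin b → F[X])}
    {S : Submodule (RatFunc F) (Fin b → RatFunc F)} {f : Fin b → F[X]} :
    f ∈ inter W S ↔ f ∈ W ∧ toRat F b f ∈ S := Iff.rfl

instance (W : Submodule F (Fin b → F[X])) [FiniteDimensional F W]
    (S : Submodule (RatFunc F) (Fin b → RatFunc F)) : FiniteDimensional F (inter W S) :=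
  Submodule.finiteDimensional_of_le (inf_le_left : inter W S ≤ W)

/-- Evaluation at `0` maps into `specialize S`, and its kernel is `X` times the same space with the
degree bound lowered by one. -/
lemma finrank_inter_degVec_le (d : ℕ) (S : Submodule (RatFunc F) (Fin b → RatFunc F)) :
    finrank F (inter (degVec F b d) S) ≤ d * finrank (RatFunc F) S := by
  induction d with
  | zero =>
    have : inter (degVec F b 0) S = ⊥ := by
      rw [eq_bot_iff]
      rintro f ⟨hf, -⟩
      rw [Submodule.mem_bot]
      funext i
      simpa using mem_degVec.1 hf i
    rw [this]; simp
  | succ d ih =>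
    set T := inter (degVec F b (d + 1)) S with hT
    let φ : T →ₗ[F] (Fin b → F) := (evalVec b 0).domRestrict T
    have hrn := LinearMap.finrank_range_add_finrank_ker φ
    have h1 : finrank F (LinearMap.range φ) ≤ finrank (RatFunc F) S := by
      rw [← finrank_specialize]
      apply Submodule.finrank_mono
      rintro _ ⟨f, rfl⟩
      exact ⟨f.1, f.2.2, rfl⟩
    have h2 : finrank F (LinearMap.ker φ) ≤ finrank F (inter (degVec F b d) S) := by
      let μ : (Fin b → F[X]) →ₗ[F] (Fin b → F[X]) :=
        (LinearMap.lsmul F[X] (Fin b → F[X]) X).restrictScalars F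
      have hle : (LinearMap.ker φ).map T.subtype ≤ (inter (degVec F b d) S).map μ := by
        rintro _ ⟨f, hf, rfl⟩
        obtain ⟨g, hg⟩ := exists_eq_X_smul (f := f.1) (by simpa [φ] using hf)
        refine ⟨g, ⟨mem_degVec.2 fun i => ?_, ?_⟩, hg.symm⟩
        · have := mem_degVec.1 f.2.1 i
          rw [hg] at this
          by_cases h0 : g i = 0
          · simp [h0]
          · simp only [Pi.smul_apply, smul_eq_mul, degree_mul, degree_X] at this
            rw [degree_eq_natDegree h0] at this ⊢
            norm_cast at this ⊢
            omega
        · exact mem_polyPart_of_smul X_ne_zero (hg ▸ f.2.2)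
      calc finrank F (LinearMap.ker φ)
          = finrank F ((LinearMap.ker φ).map T.subtype) :=
            (LinearEquiv.finrank_eq
              (Submodule.equivMapOfInjective _ T.injective_subtype _))
        _ ≤ finrank F ((inter (degVec F b d) S).map μ) := Submodule.finrank_mono hle
        _ ≤ _ := Submodule.finrank_map_le _ _
    rw [add_mul, one_mul]
    omega

end RSProfile

/-! ### Generic rank of evaluations, and constraints at a point. -/

namespace RSProfile

open Polynomial Module

variable {F : Type*} [Field F] {b : ℕ}

lemma exists_det_submatrix_ne_zero {K : Type*} [Field K] {r b : ℕ} (M : Matrix (Fin r) (Fin b) K)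
    (h : LinearIndependent K M.row) :
    ∃ e : Fin r → Fin b, (M.submatrix id e).det ≠ 0 := by
  have hr : finrank K (Submodule.span K (Set.range M.col)) = r := by
    rw [← Matrix.rank_eq_finrank_span_cols, h.rank_matrix, Fintype.card_fin]
  obtain ⟨f, hf, hli⟩ : ∃ f : Fin r → Fin r → K,
      (∀ i, f i ∈ Set.range M.col) ∧ LinearIndependent K f := by
    obtain ⟨f, hf, -, hli⟩ := Submodule.exists_fun_fin_finrank_span_eq K (Set.range M.col)
    exact ⟨f ∘ Fin.cast hr.symm, fun i => hf _, hli.comp _ (Fin.cast_injective _)⟩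
  choose e he using hf
  refine ⟨e, ?_⟩
  rw [← isUnit_iff_ne_zero, ← Matrix.isUnit_iff_isUnit_det,
    ← Matrix.linearIndependent_cols_iff_isUnit]
  convert hli using 1
  funext l
  exact he l

lemma natDegree_det_le {r d : ℕ} (M : Matrix (Fin r) (Fin r) F[X])
    (h : ∀ i j, (M i j).natDegree ≤ d) : M.det.natDegree ≤ r * d := by
  rw [Matrix.det_apply]
  refine natDegree_sum_le_of_forall_le _ _ fun σ _ => ?_
  refine (natDegree_smul_le _ _).trans ((natDegree_prod_le _ _).trans ?_)
  refine (Finset.sum_le_card_nsmul _ _ d fun i _ => h _ _).trans ?_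
  simp

-- Some maximal minor of a generic independent family in `T` is a nonzero polynomial of degree at
-- most `r * d`; the rank can drop only at its roots.
open Classical in
lemma card_eval_finrank_lt [Fintype F] {d : ℕ} (T : Submodule F (Fin b → F[X]))
    (hT : T ≤ degVec F b d) :
    (Finset.univ.filter fun x : F => finrank F (T.map (evalVec b x)) <
      finrank (RatFunc F) (Submodule.span (RatFunc F) (toRat F b '' T))).card ≤
      finrank (RatFunc F) (Submodule.span (RatFunc F) (toRat F b '' T)) * d := by
  set r := finrank (RatFunc F) (Submodule.span (RatFunc F) (toRat F b '' T)) with hr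
  obtain ⟨f, hf, hli⟩ : ∃ f : Fin r → Fin b → RatFunc F,
      (∀ i, f i ∈ toRat F b '' (T : Set (Fin b → F[X]))) ∧ LinearIndependent (RatFunc F) f := by
    obtain ⟨f, hf, -, hli⟩ := Submodule.exists_fun_fin_finrank_span_eq (RatFunc F)
      (toRat F b '' (T : Set (Fin b → F[X])))
    exact ⟨f, hf, hli⟩
  choose g hgT hgf using hf
  have hli' : LinearIndependent (RatFunc F)
      (Matrix.row ((Matrix.of g).map (algebraMap F[X] (RatFunc F)))) := by
    convert hli using 1
    funext l
    rw [← hgf l]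
    rfl
  obtain ⟨e, he⟩ := exists_det_submatrix_ne_zero _ hli'
  set M : Matrix (Fin r) (Fin r) F[X] := (Matrix.of g).submatrix id e with hM
  have hdet : M.det ≠ 0 := by
    intro h0
    apply he
    have := congrArg (algebraMap F[X] (RatFunc F)) h0
    rw [RingHom.map_det, map_zero] at this
    exact this
  have hdeg : M.det.natDegree ≤ r * d := natDegree_det_le M fun i j =>
    natDegree_le_of_degree_le (mem_degVec.1 (hT (hgT i)) (e j)).le
  refine le_trans (Finset.card_le_card (t := M.det.roots.toFinset) fun x hx => ?_)
    ((Multiset.toFinset_card_le _).trans ((card_roots' _).trans hdeg))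
  rw [Multiset.mem_toFinset, mem_roots hdet, IsRoot.def]
  by_contra hne
  rw [Finset.mem_filter] at hx
  refine absurd hx.2 (not_lt.2 ?_)
  have hMx : ((M.map (evalRingHom x))).det ≠ 0 := by
    have := RingHom.map_det (evalRingHom x) M
    rw [coe_evalRingHom] at this
    rw [this] at hne
    exact hne
  have hrows := Matrix.linearIndependent_rows_of_det_ne_zero hMx
  have hlix : LinearIndependent F fun l => evalVec b x (g l) := by
    refine LinearIndependent.of_comp (LinearMap.funLeft F F e) ?_
    exact hrows
  rw [← Fintype.card_fin r, ← finrank_span_eq_card hlix]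
  apply Submodule.finrank_mono
  rw [Submodule.span_le]
  rintro _ ⟨l, rfl⟩
  exact ⟨g l, hgT l, rfl⟩

/-- A constant matrix acting on polynomial vectors. -/
noncomputable def polyMul (A : Matrix (Fin b) (Fin b) F) :
    (Fin b → F[X]) →ₗ[F[X]] (Fin b → F[X]) :=
  (A.map C).mulVecLin

/-- A constant matrix acting on vectors of rational functions. -/
noncomputable def ratMul (A : Matrix (Fin b) (Fin b) F) :
    (Fin b → RatFunc F) →ₗ[RatFunc F] (Fin b → RatFunc F) :=
  ((A.map C).map (algebraMap F[X] (RatFunc F))).mulVecLin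

lemma toRat_polyMul (A : Matrix (Fin b) (Fin b) F) (f : Fin b → F[X]) :
    toRat F b (polyMul A f) = ratMul A (toRat F b f) := by
  funext i
  simp [polyMul, ratMul, Matrix.mulVec, dotProduct]

lemma evalVec_polyMul (A : Matrix (Fin b) (Fin b) F) (x : F) (f : Fin b → F[X]) :
    evalVec b x (polyMul A f) = A.mulVec (evalVec b x f) := by
  funext i
  simp [polyMul, Matrix.mulVec, dotProduct, eval_finsetSum]

lemma polyMul_mem_degVec (A : Matrix (Fin b) (Fin b) F) {d : ℕ} {f : Fin b → F[X]}
    (hf : f ∈ degVec F b d) : polyMul A f ∈ degVec F b d := by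
  intro i _
  simp only [polyMul, Matrix.mulVecLin_apply, Matrix.mulVec, dotProduct, Matrix.map_apply]
  refine Submodule.sum_mem _ fun j _ => ?_
  rw [← smul_eq_C_mul]
  exact Submodule.smul_mem _ _ (hf j trivial)

/-- The dimension of the image of `S` under the constant matrix `A`. -/
noncomputable def rk (A : Matrix (Fin b) (Fin b) F)
    (S : Submodule (RatFunc F) (Fin b → RatFunc F)) : ℕ :=
  finrank (RatFunc F) (S.map (ratMul A))

lemma rk_le (A : Matrix (Fin b) (Fin b) F) (S : Submodule (RatFunc F) (Fin b → RatFunc F)) :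
    rk A S ≤ finrank (RatFunc F) S := Submodule.finrank_map_le _ _

lemma rk_mono (A : Matrix (Fin b) (Fin b) F) : Monotone (rk A) := fun _ _ h =>
  Submodule.finrank_mono (Submodule.map_mono h)

lemma rk_submodular (A : Matrix (Fin b) (Fin b) F)
    (S S' : Submodule (RatFunc F) (Fin b → RatFunc F)) :
    rk A (S ⊔ S') + rk A (S ⊓ S') ≤ rk A S + rk A S' := by
  unfold rk
  rw [← Submodule.finrank_sup_add_finrank_inf_eq (S.map (ratMul A)), Submodule.map_sup]
  gcongr
  exact Submodule.finrank_mono (Submodule.map_inf_le _)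

/-- Constant matrices commute with evaluation, so the image of the specialization lies in the
specialization of the image. -/
lemma finrank_map_specialize_le (A : Matrix (Fin b) (Fin b) F)
    (S : Submodule (RatFunc F) (Fin b → RatFunc F)) :
    finrank F ((specialize S).map A.mulVecLin) ≤ rk A S := by
  unfold rk
  rw [← finrank_specialize]
  apply Submodule.finrank_mono
  rintro _ ⟨_, ⟨f, hf, rfl⟩, rfl⟩
  refine ⟨polyMul A f, ?_, evalVec_polyMul A 0 f⟩
  change toRat F b (polyMul A f) ∈ S.map (ratMul A)
  rw [toRat_polyMul]
  exact ⟨_, hf, rfl⟩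

lemma finrank_inter_supermodular (W : Submodule F (Fin b → F[X])) [FiniteDimensional F W]
    (S S' : Submodule (RatFunc F) (Fin b → RatFunc F)) :
    finrank F (inter W S) + finrank F (inter W S') ≤
      finrank F (inter W (S ⊔ S')) + finrank F (inter W (S ⊓ S')) := by
  rw [← Submodule.finrank_sup_add_finrank_inf_eq (inter W S)]
  gcongr
  · apply Submodule.finrank_mono
    refine sup_le ?_ ?_ <;> rintro f ⟨hf, hS⟩
    · exact ⟨hf, (le_sup_left : S ≤ S ⊔ S') hS⟩
    · exact ⟨hf, (le_sup_right : S' ≤ S ⊔ S') hS⟩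
  · apply Submodule.finrank_mono
    rintro f ⟨hf, hf'⟩
    exact ⟨hf.1, hf.2, hf'.2⟩

/-- The vectors of `W` whose value at `x` is annihilated by `A`. -/
noncomputable def constrain (W : Submodule F (Fin b → F[X])) (A : Matrix (Fin b) (Fin b) F)
    (x : F) : Submodule F (Fin b → F[X]) :=
  W ⊓ LinearMap.ker (A.mulVecLin ∘ₗ evalVec b x)

lemma constrain_le (W : Submodule F (Fin b → F[X])) (A : Matrix (Fin b) (Fin b) F) (x : F) :
    constrain W A x ≤ W := inf_le_left

instance (W : Submodule F (Fin b → F[X])) [FiniteDimensional F W]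
    (A : Matrix (Fin b) (Fin b) F) (x : F) : FiniteDimensional F (constrain W A x) :=
  Submodule.finiteDimensional_of_le (constrain_le W A x)

lemma finrank_inter_constrain_add (W : Submodule F (Fin b → F[X])) [FiniteDimensional F W]
    (A : Matrix (Fin b) (Fin b) F) (x : F) (S : Submodule (RatFunc F) (Fin b → RatFunc F)) :
    finrank F (inter (constrain W A x) S) +
      finrank F ((inter W S).map (A.mulVecLin ∘ₗ evalVec b x)) = finrank F (inter W S) := by
  set φ := (A.mulVecLin ∘ₗ evalVec b x).domRestrict (inter W S) with hφ
  have hrn := LinearMap.finrank_range_add_finrank_ker φ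
  have h1 : LinearMap.range φ = (inter W S).map (A.mulVecLin ∘ₗ evalVec b x) := by
    rw [hφ, LinearMap.range_domRestrict]
  have h2 : (LinearMap.ker φ).map (inter W S).subtype = inter (constrain W A x) S := by
    ext f
    constructor
    · rintro ⟨g, hg, rfl⟩
      exact ⟨⟨g.2.1, hg⟩, g.2.2⟩
    · rintro ⟨⟨hf, hk⟩, hS⟩
      exact ⟨⟨f, hf, hS⟩, hk, rfl⟩
  rw [← h2, ← h1, ← hrn, add_comm]
  congr 1
  exact (LinearEquiv.finrank_eq
    (Submodule.equivMapOfInjective _ (inter W S).injective_subtype _)).symm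

/-- For all but few points, imposing the constraint `A` at the point decreases the dimension
of `W ∩ S` by at least `rk A S`, provided `W ∩ S` spans `S`. -/
lemma card_finrank_inter_constrain [Fintype F] [DecidableEq F] {d : ℕ}
    (W : Submodule F (Fin b → F[X])) [FiniteDimensional F W] (hW : W ≤ degVec F b d)
    (A : Matrix (Fin b) (Fin b) F) (S : Submodule (RatFunc F) (Fin b → RatFunc F))
    (hS : Submodule.span (RatFunc F) (toRat F b '' (inter W S)) = S) :
    (Finset.univ.filter fun x : F =>
      finrank F (inter W S) < finrank F (inter (constrain W A x) S) + rk A S).card ≤ b * d := by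
  classical
  set T := (inter W S).map ((polyMul A).restrictScalars F) with hT
  have hTd : T ≤ degVec F b d := by
    rintro _ ⟨f, hf, rfl⟩
    exact polyMul_mem_degVec A (hW hf.1)
  have hspan : Submodule.span (RatFunc F) (toRat F b '' T) = S.map (ratMul A) := by
    conv_rhs => rw [← hS, Submodule.map_span]
    congr 1
    ext v
    constructor
    · rintro ⟨_, ⟨f, hf, rfl⟩, rfl⟩
      exact ⟨_, ⟨f, hf, rfl⟩, (toRat_polyMul A f).symm⟩
    · rintro ⟨_, ⟨f, hf, rfl⟩, rfl⟩
      exact ⟨_, ⟨f, hf, rfl⟩, toRat_polyMul A f⟩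
  have hcard := card_eval_finrank_lt T hTd
  rw [hspan] at hcard
  have hrk : finrank (RatFunc F) (S.map (ratMul A)) ≤ b := by
    simpa using Submodule.finrank_le (S.map (ratMul A))
  refine le_trans (Finset.card_le_card fun x hx => ?_) (hcard.trans (Nat.mul_le_mul_right d hrk))
  simp only [Finset.mem_filter, Finset.mem_univ, true_and] at hx ⊢
  have hmap : T.map (evalVec b x) = (inter W S).map (A.mulVecLin ∘ₗ evalVec b x) := by
    rw [hT, ← Submodule.map_comp]
    congr 1
    refine LinearMap.ext fun f => ?_
    exact evalVec_polyMul A x f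
  rw [hmap]
  have := finrank_inter_constrain_add W A x S
  unfold rk at hx
  omega

end RSProfile

/-! ### The slack condition and its nearly extremal subspaces. -/

namespace RSProfile

open Polynomial Module

variable {F : Type*} [Field F] {b : ℕ}

/-- The slack condition: `c` bounds the dimensions of the intersections with `W`, up to a linear
term, with a margin that is strictly convex in the dimension. -/
def Slack (W : Submodule F (Fin b → F[X]))
    (c : Submodule (RatFunc F) (Fin b → RatFunc F) → ℕ) (N m : ℕ) : Prop :=
  ∀ S : Submodule (RatFunc F) (Fin b → RatFunc F),
    finrank F (inter W S) + b * finrank (RatFunc F) S ^ 2 + m * finrank (RatFunc F) S ≤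
      c S + N * finrank (RatFunc F) S

/-- The subspace `S` is nearly extremal for the slack condition. -/
def NearTight (W : Submodule F (Fin b → F[X]))
    (c : Submodule (RatFunc F) (Fin b → RatFunc F) → ℕ) (N m : ℕ)
    (S : Submodule (RatFunc F) (Fin b → RatFunc F)) : Prop :=
  c S + N * finrank (RatFunc F) S <
    finrank F (inter W S) + b * finrank (RatFunc F) S ^ 2 + m * finrank (RatFunc F) S +
      finrank (RatFunc F) S

lemma Slack.mono {W : Submodule F (Fin b → F[X])}
    {c : Submodule (RatFunc F) (Fin b → RatFunc F) → ℕ} {N m : ℕ} (h : Slack W c N m) {m' : ℕ} (hm : m' ≤ m) : Slack W c N m' := fun S => by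
  have := h S
  have := Nat.mul_le_mul_right (finrank (RatFunc F) S) hm
  omega

/-- The span `S₀` of `W ∩ S` has the same intersection with `W`. If it were smaller than `S`, then
passing from `S₀` to `S` would gain at least `N - m` per extra dimension on the right-hand side,
more than the terms `b s² + s ≤ b³ + b` can offset. -/
lemma NearTight.span_eq {W : Submodule F (Fin b → F[X])}
    {c : Submodule (RatFunc F) (Fin b → RatFunc F) → ℕ} {N m : ℕ} (h : Slack W c N m) (hc : Monotone c) (hN : m + b ^ 3 + b ≤ N)
    {S : Submodule (RatFunc F) (Fin b → RatFunc F)} (hS : NearTight W c N m S) :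
    Submodule.span (RatFunc F) (toRat F b '' (inter W S)) = S := by
  set S₀ := Submodule.span (RatFunc F) (toRat F b '' (inter W S)) with hS₀
  have hle : S₀ ≤ S := by
    rw [hS₀, Submodule.span_le]
    rintro _ ⟨f, hf, rfl⟩
    exact hf.2
  by_contra hne
  have hlt := Submodule.finrank_lt_finrank_of_lt (lt_of_le_of_ne hle hne)
  have hint : inter W S₀ = inter W S := by
    apply le_antisymm
    · exact fun f hf => ⟨hf.1, hle hf.2⟩
    · exact fun f hf => ⟨hf.1, Submodule.subset_span ⟨f, hf, rfl⟩⟩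
  have h1 := h S₀
  have h2 := hc hle
  have h4 : finrank (RatFunc F) S ≤ b := by simpa using Submodule.finrank_le S
  rw [hint] at h1
  unfold NearTight at hS
  obtain ⟨a, ha⟩ := Nat.exists_eq_add_of_lt hlt
  generalize finrank (RatFunc F) S₀ = s₀ at *
  rw [ha] at hS h4
  have h5 : (m + b ^ 3 + b) * (a + 1) ≤ N * (a + 1) := Nat.mul_le_mul_right _ hN
  have h6 : b * (s₀ + a + 1) ^ 2 ≤ b * b ^ 2 := Nat.mul_le_mul_left _ (Nat.pow_le_pow_left h4 2)
  nlinarith [Nat.zero_le ((b ^ 3 + b) * a), Nat.zero_le (b * s₀ ^ 2)]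

section

variable {W : Submodule F (Fin b → F[X])} [FiniteDimensional F W]
  {c : Submodule (RatFunc F) (Fin b → RatFunc F) → ℕ} {N m : ℕ}

/-- Uncrossing: for incomparable `S`, `S'` the squared dimensions of `S ⊔ S'` and `S ⊓ S'` exceed
those of `S` and `S'` by `2(a + 1)(a' + 1)`. Multiplied by `b` this is at least `2b ≥ dim S + dim
S'`, the total tolerance in near tightness. -/
lemma NearTight.le_or_le (h : Slack W c N m)
    (hc : ∀ S S', c (S ⊔ S') + c (S ⊓ S') ≤ c S + c S')
    {S S' : Submodule (RatFunc F) (Fin b → RatFunc F)}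
    (hS : NearTight W c N m S) (hS' : NearTight W c N m S') : S ≤ S' ∨ S' ≤ S := by
  by_contra! hne
  have h1 : finrank (RatFunc F) ↥(S ⊓ S') < finrank (RatFunc F) S :=
    Submodule.finrank_lt_finrank_of_lt (inf_lt_left.2 hne.1)
  have h2 : finrank (RatFunc F) ↥(S ⊓ S') < finrank (RatFunc F) S' :=
    Submodule.finrank_lt_finrank_of_lt (inf_lt_right.2 hne.2)
  have h3 := Submodule.finrank_sup_add_finrank_inf_eq S S'
  have h4 : finrank (RatFunc F) S ≤ b := by simpa using Submodule.finrank_le S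
  have h5 : finrank (RatFunc F) S' ≤ b := by simpa using Submodule.finrank_le S'
  have h6 := h (S ⊔ S')
  have h7 := h (S ⊓ S')
  have h8 := hc S S'
  have h9 := finrank_inter_supermodular W S S'
  unfold NearTight at hS hS'
  obtain ⟨a, ha⟩ := Nat.exists_eq_add_of_lt h1
  obtain ⟨a', ha'⟩ := Nat.exists_eq_add_of_lt h2
  generalize finrank (RatFunc F) ↥(S ⊓ S') = r at *
  have hp : finrank (RatFunc F) ↥(S ⊔ S') = r + (a + 1) + (a' + 1) := by omega
  rw [hp] at h6
  rw [ha] at hS h4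
  rw [ha'] at hS' h5
  have h10 : b * 1 ≤ b * ((a + 1) * (a' + 1)) :=
    Nat.mul_le_mul_left _ (Nat.mul_pos (Nat.succ_pos _) (Nat.succ_pos _))
  nlinarith

lemma finrank_inter_constrain_le (A : Matrix (Fin b) (Fin b) F) (x : F)
    (S : Submodule (RatFunc F) (Fin b → RatFunc F)) :
    finrank F (inter (constrain W A x) S) ≤ finrank F (inter W S) :=
  Submodule.finrank_mono fun _ hf => ⟨hf.1.1, hf.2⟩

/-- Even if no dimension drops, the rank spent is at most `dim S`, which one unit of margin pays
for. -/
lemma Slack.constrain_of_lt {A : Matrix (Fin b) (Fin b) F}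
    (h : Slack W (fun S => c S + rk A S) N (m + 1)) (x : F) : Slack (constrain W A x) c N m := by
  intro S
  have h1 := h S
  have h2 := finrank_inter_constrain_le (W := W) A x S
  have h3 := rk_le A S
  simp only [add_mul, one_mul] at h1
  omega

end

variable [Fintype F]

open Classical in
/-- The points at which imposing `A` on `W` does not reduce the dimension of some nearly extremal
intersection as much as it does generically. -/
noncomputable def badPoints (W : Submodule F (Fin b → F[X]))
    (c : Submodule (RatFunc F) (Fin b → RatFunc F) → ℕ) (N m : ℕ)
    (A : Matrix (Fin b) (Fin b) F) : Finset F :=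
  Finset.univ.filter fun x => ∃ S, NearTight W c N m S ∧
    finrank F (inter W S) < finrank F (inter (constrain W A x) S) + rk A S

section

variable {W : Submodule F (Fin b → F[X])} [FiniteDimensional F W]
  {c : Submodule (RatFunc F) (Fin b → RatFunc F) → ℕ} {N m : ℕ}

lemma card_badPoints_le {d : ℕ} (hW : W ≤ degVec F b d) (h : Slack W c N m) (hmono : Monotone c)
    (hc : ∀ S S', c (S ⊔ S') + c (S ⊓ S') ≤ c S + c S') (hN : m + b ^ 3 + b ≤ N)
    (A : Matrix (Fin b) (Fin b) F) : (badPoints W c N m A).card ≤ b * (b * d) := by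
  classical
  -- Nearly tight subspaces form a chain, so there is at most one in each dimension `s`.
  let P : ℕ → Finset F := fun s =>
    if hs : ∃ S, NearTight W c N m S ∧ finrank (RatFunc F) S = s then
      Finset.univ.filter fun x => finrank F (inter W hs.choose) <
        finrank F (inter (constrain W A x) hs.choose) + rk A hs.choose
    else ∅
  have hP : ∀ s ∈ Finset.Icc 1 b, (P s).card ≤ b * d := by
    intro s _
    by_cases hs : ∃ S, NearTight W c N m S ∧ finrank (RatFunc F) S = s
    · simp only [P, dif_pos hs]
      exact card_finrank_inter_constrain W hW A _ (hs.choose_spec.1.span_eq h hmono hN)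
    · simp [P, dif_neg hs]
  have hsub : badPoints W c N m A ⊆ (Finset.Icc 1 b).biUnion P := by
    intro x hx
    obtain ⟨S, hS, hlt⟩ := (Finset.mem_filter.1 hx).2
    have hs : ∃ S', NearTight W c N m S' ∧ finrank (RatFunc F) S' = finrank (RatFunc F) S :=
      ⟨S, hS, rfl⟩
    have heq : hs.choose = S := by
      rcases hs.choose_spec.1.le_or_le h hc hS with hle | hle
      · exact Submodule.eq_of_le_of_finrank_eq hle hs.choose_spec.2
      · exact (Submodule.eq_of_le_of_finrank_eq hle hs.choose_spec.2.symm).symm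
    refine Finset.mem_biUnion.2 ⟨finrank (RatFunc F) S, Finset.mem_Icc.2 ⟨?_, ?_⟩, ?_⟩
    -- The zero subspace is never nearly tight, so only the `b` dimensions from `1` to `b`
    -- contribute.
    · by_contra h0
      have h0 : finrank (RatFunc F) S = 0 := by omega
      have h1 := h S
      unfold NearTight at hS
      rw [h0] at h1 hS
      omega
    · simpa using Submodule.finrank_le S
    · simp only [P, dif_pos hs, Finset.mem_filter, Finset.mem_univ, true_and]
      rw [heq]
      exact hlt
  calc (badPoints W c N m A).card ≤ ((Finset.Icc 1 b).biUnion P).card := Finset.card_le_card hsub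
    _ ≤ (Finset.Icc 1 b).card * (b * d) := Finset.card_biUnion_le_card_mul _ _ _ hP
    _ = b * (b * d) := by simp

lemma badPoints_zero : badPoints W c N m (0 : Matrix (Fin b) (Fin b) F) = ∅ := by
  classical
  rw [Finset.eq_empty_iff_forall_notMem]
  intro x hx
  obtain ⟨S, -, hlt⟩ := (Finset.mem_filter.1 hx).2
  have h1 : finrank F (inter (constrain W 0 x) S) ≤ finrank F (inter W S) :=
    Submodule.finrank_mono fun f hf => ⟨hf.1.1, hf.2⟩
  have h2 : rk (0 : Matrix (Fin b) (Fin b) F) S = 0 := by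
    have : ratMul (0 : Matrix (Fin b) (Fin b) F) = 0 := by
      ext; simp [ratMul]
    rw [rk, this, Submodule.map_zero, finrank_bot]
  omega

/-- For nearly tight `S` the dimension drops by at least the rank spent; for the others the surplus
is at least `dim S`, hence at least that rank. -/
lemma Slack.constrain {A : Matrix (Fin b) (Fin b) F}
    (h : Slack W (fun S => c S + rk A S) N m) {x : F}
    (hx : x ∉ badPoints W (fun S => c S + rk A S) N m A) : Slack (constrain W A x) c N m := by
  classical
  intro S
  have h1 := h S
  have h2 := finrank_inter_constrain_le (W := W) A x S
  have h3 := rk_le A S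
  by_cases hS : NearTight W (fun S => c S + rk A S) N m S
  · have h4 : ¬ finrank F (inter W S) < finrank F (inter (RSProfile.constrain W A x) S) + rk A S :=
      fun hlt => hx (Finset.mem_filter.2 ⟨Finset.mem_univ _, S, hS, hlt⟩)
    simp only at h1
    omega
  · unfold NearTight at hS
    simp only at hS
    omega

end

end RSProfile

/-! ### Revealing the evaluation points one at a time. -/

namespace RSProfile

open Polynomial Module

variable {F : Type*} [Field F] {n b : ℕ}

/-- The polynomial vectors of degree less than `d` that satisfy the first `i` constraints. -/
noncomputable def sol (A : Fin n → Matrix (Fin b) (Fin b) F) (α : Fin n → F) (d i : ℕ) :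
    Submodule F (Fin b → F[X]) :=
  degVec F b d ⊓ ⨅ j : Fin n, ⨅ _ : (j : ℕ) < i,
    LinearMap.ker ((A j).mulVecLin ∘ₗ evalVec b (α j))

lemma mem_sol {A : Fin n → Matrix (Fin b) (Fin b) F} {α : Fin n → F} {d i : ℕ}
    {f : Fin b → F[X]} : f ∈ sol A α d i ↔
      f ∈ degVec F b d ∧ ∀ j : Fin n, (j : ℕ) < i → (A j).mulVec (evalVec b (α j) f) = 0 := by
  simp [sol, Submodule.mem_iInf]

lemma sol_le (A : Fin n → Matrix (Fin b) (Fin b) F) (α : Fin n → F) (d i : ℕ) :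
    sol A α d i ≤ degVec F b d := inf_le_left

instance (A : Fin n → Matrix (Fin b) (Fin b) F) (α : Fin n → F) (d i : ℕ) :
    FiniteDimensional F (sol A α d i) :=
  Submodule.finiteDimensional_of_le (sol_le A α d i)

lemma sol_zero (A : Fin n → Matrix (Fin b) (Fin b) F) (α : Fin n → F) (d : ℕ) :
    sol A α d 0 = degVec F b d := by
  ext f; simp [mem_sol]

lemma sol_succ (A : Fin n → Matrix (Fin b) (Fin b) F) (α : Fin n → F) (d : ℕ) (i : Fin n) :
    sol A α d (i + 1) = constrain (sol A α d i) (A i) (α i) := by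
  ext f
  simp only [mem_sol, constrain, Submodule.mem_inf, LinearMap.mem_ker, LinearMap.comp_apply,
    Matrix.mulVecLin_apply, and_assoc, Nat.lt_succ_iff_lt_or_eq]
  refine and_congr_right fun _ => ⟨fun h => ⟨fun j hj => h j (Or.inl hj), h i (Or.inr rfl)⟩, ?_⟩
  rintro ⟨h1, h2⟩ j (hj | hj)
  · exact h1 j hj
  · rw [Fin.ext hj]; exact h2

lemma sol_congr (A : Fin n → Matrix (Fin b) (Fin b) F) {α α' : Fin n → F} (d : ℕ) {i : Fin n}
    (h : ∀ j < i, α j = α' j) : sol A α d i = sol A α' d i := by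
  ext f
  simp only [mem_sol]
  refine and_congr_right fun _ => forall₂_congr fun j hj => ?_
  rw [h j hj]

/-- The total rank on `S` of the constraints from the `i`-th on. -/
noncomputable def future (A : Fin n → Matrix (Fin b) (Fin b) F) (i : ℕ)
    (S : Submodule (RatFunc F) (Fin b → RatFunc F)) : ℕ :=
  ∑ j ∈ Finset.univ.filter (fun j : Fin n => i ≤ (j : ℕ)), rk (A j) S

lemma future_mono (A : Fin n → Matrix (Fin b) (Fin b) F) (i : ℕ) : Monotone (future A i) :=
  fun _ _ h => Finset.sum_le_sum fun j _ => rk_mono (A j) h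

lemma future_submodular (A : Fin n → Matrix (Fin b) (Fin b) F) (i : ℕ)
    (S S' : Submodule (RatFunc F) (Fin b → RatFunc F)) :
    future A i (S ⊔ S') + future A i (S ⊓ S') ≤ future A i S + future A i S' := by
  unfold future
  rw [← Finset.sum_add_distrib, ← Finset.sum_add_distrib]
  exact Finset.sum_le_sum fun j _ => rk_submodular (A j) S S'

lemma future_eq (A : Fin n → Matrix (Fin b) (Fin b) F) (i : Fin n) :
    future A i = fun S => future A (i + 1) S + rk (A i) S := by
  funext S
  unfold future
  have : (Finset.univ.filter fun j : Fin n => (i : ℕ) ≤ j) =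
      insert i (Finset.univ.filter fun j : Fin n => (i : ℕ) + 1 ≤ j) := by
    ext j
    simp only [Finset.mem_filter, Finset.mem_univ, true_and, Finset.mem_insert, Fin.ext_iff]
    omega
  rw [this, Finset.sum_insert (by simp), add_comm]

/-- The hypothesis on subspaces of `F^b` is applied to the specialization of `S`, which has the same
dimension and no larger images. The convex term is absorbed through `b s² ≤ b² s`. -/
lemma slack_zero (A : Fin n → Matrix (Fin b) (Fin b) F) (α : Fin n → F) {k N m κ : ℕ}
    (hκ : k + m + b ^ 2 ≤ κ)
    (hA : ∀ U : Submodule F (Fin b → F),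
      κ * finrank F U ≤ ∑ i, finrank F (U.map (A i).mulVecLin)) :
    Slack (sol A α (k + N) 0) (future A 0) N m := by
  intro S
  rw [sol_zero]
  have h1 := finrank_inter_degVec_le (k + N) S
  have h2 : κ * finrank (RatFunc F) S ≤ future A 0 S := by
    rw [← finrank_specialize]
    refine (hA (specialize S)).trans ?_
    simp only [future, zero_le, Finset.filter_true]
    exact Finset.sum_le_sum fun j _ => finrank_map_specialize_le (A j) S
  have h4 : finrank (RatFunc F) S ≤ b := by simpa using Submodule.finrank_le S
  generalize finrank (RatFunc F) S = s at *
  have h5 : (k + m + b ^ 2) * s ≤ κ * s := Nat.mul_le_mul_right _ hκ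
  have h6 : b * s * s ≤ b * s * b := Nat.mul_le_mul_left _ h4
  nlinarith

lemma lt_finrank_inter_span_of_mem_sol {A : Fin n → Matrix (Fin b) (Fin b) F} {α : Fin n → F} {k : ℕ}
    (N i : ℕ) {f : Fin b → F[X]} (hf0 : f ≠ 0) (hf : f ∈ sol A α k i) :
    N < finrank F (inter (sol A α (k + N) i)
      (Submodule.span (RatFunc F) {toRat F b f})) := by
  let μ : F[X] →ₗ[F] (Fin b → F[X]) := (LinearMap.toSpanSingleton F[X] _ f).restrictScalars F
  have hμ : Function.Injective μ := by
    intro p q hpq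
    exact smul_left_injective F[X] hf0 hpq
  have hle : (degreeLT F (N + 1)).map μ ≤ inter (sol A α (k + N) i)
      (Submodule.span (RatFunc F) {toRat F b f}) := by
    rintro _ ⟨p, hp, rfl⟩
    rw [mem_sol] at hf
    refine mem_inter.2 ⟨mem_sol.2 ⟨mem_degVec.2 fun l => ?_, fun j hj => ?_⟩, ?_⟩
    · change (p * f l).degree < _
      by_cases h0 : p * f l = 0
      · simp [h0]
      · have hp0 := left_ne_zero_of_mul h0
        have hl0 := right_ne_zero_of_mul h0
        have h1 := mem_degreeLT.1 hp
        have h2 := mem_degVec.1 hf.1 l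
        rw [degree_mul, degree_eq_natDegree hp0, degree_eq_natDegree hl0]
        rw [degree_eq_natDegree hp0] at h1
        rw [degree_eq_natDegree hl0] at h2
        norm_cast at h1 h2 ⊢
        omega
    · change (A j).mulVec (evalVec b (α j) (p • f)) = 0
      rw [evalVec_smul, Matrix.mulVec_smul, hf.2 j hj, smul_zero]
    · change toRat F b (p • f) ∈ _
      rw [map_smul, ← algebraMap_smul (RatFunc F) p]
      exact Submodule.smul_mem _ _ (Submodule.mem_span_singleton_self _)
  have h1 := Submodule.finrank_mono hle
  rw [← LinearEquiv.finrank_eq (Submodule.equivMapOfInjective μ hμ _),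
    LinearEquiv.finrank_eq (degreeLTEquiv F (N + 1)), finrank_fin_fun] at h1
  exact h1

variable [Fintype F]

open Classical in
/-- There are few bad values for each evaluation point, determined by the previous ones, such
that many points have to be bad for the constraints to have a nonzero solution. -/
theorem exists_bad_points (A : Fin n → Matrix (Fin b) (Fin b) F) {k t κ : ℕ}
    (hκ : k + t + b ^ 2 ≤ κ)
    (hA : ∀ U : Submodule F (Fin b → F),
      κ * finrank F U ≤ ∑ i, finrank F (U.map (A i).mulVecLin)) :
    ∃ bad : Fin n → (Fin n → F) → Finset F,
      (∀ i α α', (∀ j < i, α j = α' j) → bad i α = bad i α') ∧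
      (∀ i α, (bad i α).card ≤ b * (b * (k + t + b ^ 3 + b))) ∧
      (∀ i α, A i = 0 → bad i α = ∅) ∧
      ∀ α f, f ≠ 0 → f ∈ degVec F b k → (∀ i, (A i).mulVec (evalVec b (α i) f) = 0) →
        t ≤ (Finset.univ.filter fun i => α i ∈ bad i α).card := by
  -- The least `N` for which nearly tight subspaces are spanned by their part in `W` at every margin
  -- up to `t`.
  set N := t + b ^ 3 + b with hN
  -- The best margin currently available is a function of the earlier points only, so the bad sets
  -- are too. The search returns `0` also when no margin works, hence the test in `bad`.
  let lev : (Fin n → F) → ℕ → ℕ := fun α i =>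
    Nat.findGreatest (Slack (sol A α (k + N) i) (future A i) N) t
  let bad : Fin n → (Fin n → F) → Finset F := fun i α =>
    if Slack (sol A α (k + N) i) (future A i) N (lev α i) then
      badPoints (sol A α (k + N) i) (future A i) N (lev α i) (A i) else ∅
  refine ⟨bad, fun i α α' h => ?_, fun i α => ?_, fun i α h => ?_, fun α f hf0 hfd hf => ?_⟩
  · simp only [bad, lev]
    rw [sol_congr A (k + N) h]
  · by_cases hs : Slack (sol A α (k + N) i) (future A i) N (lev α i)
    · simp only [bad, if_pos hs]
      have hlev : lev α i ≤ t := Nat.findGreatest_le t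
      have := card_badPoints_le (sol_le A α (k + N) i) hs (future_mono A i)
        (future_submodular A i) (by omega) (A i)
      have hkN : k + N = k + t + b ^ 3 + b := by omega
      exact this.trans_eq (by rw [hkN])
    · simp [bad, if_neg hs]
  · simp only [bad, h, badPoints_zero, ite_self]
  · by_contra! hlt
    -- Each bad point met so far has cost at most one unit of the initial margin `t`.
    have key : ∀ i ≤ n, Slack (sol A α (k + N) i) (future A i) N
        (t - (Finset.univ.filter fun j : Fin n => (j : ℕ) < i ∧ α j ∈ bad j α).card) := by
      intro i
      induction i with
      | zero => exact fun _ => (slack_zero A α hκ hA).mono (Nat.sub_le _ _)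
      | succ i ih =>
        intro hi
        set cnt := (Finset.univ.filter fun j : Fin n => (j : ℕ) < i ∧ α j ∈ bad j α).card
          with hcnt
        have hih := ih (by omega)
        let i' : Fin n := ⟨i, hi⟩
        have hcnt_lt : cnt ≤ (Finset.univ.filter fun j => α j ∈ bad j α).card :=
          Finset.card_le_card fun j hj => by
            simp only [Finset.mem_filter, Finset.mem_univ, true_and] at hj ⊢
            exact hj.2
        have hlev : t - cnt ≤ lev α i := Nat.le_findGreatest (Nat.sub_le _ _) hih
        have hslack : Slack (sol A α (k + N) i) (future A i) N (lev α i) :=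
          Nat.findGreatest_spec (P := Slack (sol A α (k + N) i) (future A i) N)
            (Nat.sub_le t cnt) hih
        have hsucc : sol A α (k + N) (i + 1) = constrain (sol A α (k + N) i) (A i') (α i') :=
          sol_succ A α (k + N) i'
        have hfut : future A i = fun S => future A (i + 1) S + rk (A i') S := future_eq A i'
        by_cases hbad : α i' ∈ bad i' α
        · have hc : cnt + 1 ≤
              (Finset.univ.filter fun j : Fin n => (j : ℕ) < i + 1 ∧ α j ∈ bad j α).card := by
            rw [hcnt, ← Finset.card_insert_of_notMem (a := i') (by simp [i'])]
            refine Finset.card_le_card fun j hj => ?_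
            simp only [Finset.mem_insert, Finset.mem_filter, Finset.mem_univ, true_and] at hj ⊢
            rcases hj with rfl | hj
            · exact ⟨Nat.lt_succ_self i, hbad⟩
            · exact ⟨by omega, hj.2⟩
          have hpos : t - cnt = (t - cnt - 1) + 1 := by omega
          rw [hfut, hpos] at hih
          rw [hsucc]
          exact (hih.constrain_of_lt (α i')).mono (by omega)
        · have hc : cnt ≤
              (Finset.univ.filter fun j : Fin n => (j : ℕ) < i + 1 ∧ α j ∈ bad j α).card := by
            refine Finset.card_le_card fun j hj => ?_
            simp only [Finset.mem_filter, Finset.mem_univ, true_and] at hj ⊢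
            exact ⟨by omega, hj.2⟩
          have hbad' : α i' ∉ badPoints (sol A α (k + N) i) (future A i) N (lev α i) (A i') := by
            simpa only [bad, i', if_pos hslack] using hbad
          rw [hfut] at hslack hbad'
          rw [hsucc]
          exact (hslack.constrain hbad').mono (by omega)
    -- No constraints remain, so slack on the line of `f` bounds the intersection by `N`, against
    -- the `N + 1` independent multiples of `f`.
    have hend := key n le_rfl (Submodule.span (RatFunc F) {toRat F b f})
    have hfut : future A n (Submodule.span (RatFunc F) {toRat F b f}) = 0 := by
      unfold future
      refine Finset.sum_eq_zero fun j hj => ?_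
      have := (Finset.mem_filter.1 hj).2
      omega
    have hrank : finrank (RatFunc F) (Submodule.span (RatFunc F) {toRat F b f}) = 1 :=
      finrank_span_singleton fun h => hf0 (toRat_injective (by rw [h, map_zero]))
    have hdim := lt_finrank_inter_span_of_mem_sol (A := A) (α := α) (k := k) N n hf0
      (mem_sol.2 ⟨hfd, fun j _ => hf j⟩)
    rw [hfut, hrank] at hend
    omega

end RSProfile

/-! ### Counting vectors with many bad coordinates. -/

namespace RSProfile

open Module

/-- If each coordinate has at most `D` bad values, determined by the previous coordinates, then
few vectors have at least `t` bad coordinates. -/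
theorem card_bad_coordinates_le {F : Type*} [Fintype F] [Nonempty F] [DecidableEq F] (D : ℕ) :
    ∀ (n t : ℕ) (bad : Fin n → (Fin n → F) → Finset F),
      (∀ i α α', (∀ j < i, α j = α' j) → bad i α = bad i α') → (∀ i α, (bad i α).card ≤ D) →
      (Finset.univ.filter fun α : Fin n → F =>
        t ≤ (Finset.univ.filter fun i => α i ∈ bad i α).card).card * Fintype.card F ^ t ≤
        n.choose t * D ^ t * Fintype.card F ^ n := by
  intro n
  induction n with
  | zero =>
    intro t bad _ _
    cases t with
    | zero => simp
    | succ t => simp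
  | succ n ih =>
    intro t bad hpred hD
    cases t with
    | zero => simp
    | succ t =>
      obtain ⟨x₀⟩ := ‹Nonempty F›
      -- The filler `x₀` is immaterial: no bad set depends on the last coordinate.
      let ext : (Fin n → F) → Fin (n + 1) → F := fun β => Fin.snoc β x₀
      let bad' : Fin n → (Fin n → F) → Finset F := fun i β => bad i.castSucc (ext β)
      have hpred' : ∀ i β β', (∀ j < i, β j = β' j) → bad' i β = bad' i β' := by
        intro i β β' h
        refine hpred _ _ _ fun j hj => ?_
        have hj' : (j : ℕ) < n := lt_trans (Fin.lt_def.1 hj) i.2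
        obtain ⟨j, rfl⟩ : ∃ j' : Fin n, j = j'.castSucc := ⟨⟨j, hj'⟩, rfl⟩
        simpa [ext] using h j (by simpa using hj)
      have hD' : ∀ i β, (bad' i β).card ≤ D := fun i β => hD _ _
      let G : ℕ → Finset (Fin n → F) := fun t => Finset.univ.filter fun β =>
        t ≤ (Finset.univ.filter fun i => β i ∈ bad' i β).card
      -- Either the first `n` coordinates already contain `t + 1` bad ones, or they contain `t` and
      -- the last is bad; this is Pascal's rule.
      let Q : Finset (Σ _ : Fin n → F, F) := (G (t + 1)).sigma (fun _ => Finset.univ) ∪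
        (G t).sigma (fun β => bad (Fin.last n) (ext β))
      have hsub : (Finset.univ.filter fun α : Fin (n + 1) → F =>
          t + 1 ≤ (Finset.univ.filter fun i => α i ∈ bad i α).card) ⊆
          Q.image fun p => (Fin.snoc p.1 p.2 : Fin (n + 1) → F) := by
        intro α hα
        simp only [Finset.mem_filter, Finset.mem_univ, true_and] at hα
        refine Finset.mem_image.2 ⟨⟨Fin.init α, α (Fin.last n)⟩, ?_, Fin.snoc_init_self α⟩
        have hagree : ∀ j : Fin (n + 1), j < Fin.last n → α j = ext (Fin.init α) j := by
          intro j hj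
          obtain ⟨j, rfl⟩ : ∃ j' : Fin n, j = j'.castSucc := ⟨⟨j, hj⟩, rfl⟩
          simp [ext, Fin.init]
        have hcast : ∀ i : Fin n, bad i.castSucc α = bad' i (Fin.init α) := fun i =>
          hpred _ _ _ fun j hj => hagree j (hj.trans (Fin.castSucc_lt_last i))
        have hlast : bad (Fin.last n) α = bad (Fin.last n) (ext (Fin.init α)) :=
          hpred _ _ _ hagree
        rw [Fin.univ_castSuccEmb, Finset.filter_cons] at hα
        have hmap : ((Finset.univ.map Fin.castSuccEmb).filter fun i => α i ∈ bad i α).card =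
            (Finset.univ.filter fun i => Fin.init α i ∈ bad' i (Fin.init α)).card := by
          rw [Finset.filter_map, Finset.card_map]
          refine congrArg Finset.card (Finset.filter_congr fun i _ => ?_)
          change α i.castSucc ∈ bad i.castSucc α ↔ _
          rw [hcast]
          rfl
        by_cases hl : α (Fin.last n) ∈ bad (Fin.last n) α
        · rw [if_pos hl, Finset.card_cons, hmap] at hα
          refine Finset.mem_union_right _ (Finset.mem_sigma.2 ⟨?_, hlast ▸ hl⟩)
          exact Finset.mem_filter.2 ⟨Finset.mem_univ _, Nat.le_of_succ_le_succ hα⟩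
        · rw [if_neg hl, hmap] at hα
          refine Finset.mem_union_left _ (Finset.mem_sigma.2 ⟨?_, Finset.mem_univ _⟩)
          exact Finset.mem_filter.2 ⟨Finset.mem_univ _, hα⟩
      have hcard : (Finset.univ.filter fun α : Fin (n + 1) → F =>
          t + 1 ≤ (Finset.univ.filter fun i => α i ∈ bad i α).card).card ≤
          (G (t + 1)).card * Fintype.card F + (G t).card * D := by
        refine (Finset.card_le_card hsub).trans (Finset.card_image_le.trans
          ((Finset.card_union_le _ _).trans ?_))
        rw [Finset.card_sigma, Finset.card_sigma]
        gcongr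
        · simp
        · exact Finset.sum_le_card_nsmul _ _ _ fun β _ => hD _ _
      have h1 := ih (t + 1) bad' hpred' hD'
      have h2 := ih t bad' hpred' hD'
      change (G (t + 1)).card * _ ≤ _ at h1
      change (G t).card * _ ≤ _ at h2
      set q := Fintype.card F
      calc _ ≤ ((G (t + 1)).card * q + (G t).card * D) * q ^ (t + 1) := by gcongr
        _ = ((G (t + 1)).card * q ^ (t + 1)) * q + ((G t).card * q ^ t) * (D * q) := by ring
        _ ≤ (n.choose (t + 1) * D ^ (t + 1) * q ^ n) * q +
            (n.choose t * D ^ t * q ^ n) * (D * q) := by gcongr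
        _ = (n + 1).choose (t + 1) * D ^ (t + 1) * q ^ (n + 1) := by
          rw [Nat.choose_succ_succ']; ring

end RSProfile

/-! ### Splitting a profile of large slope. -/

namespace RSProfile

open Module

variable {F : Type*} [Field F] {n b : ℕ}

/-- The dimension of the image of `U` modulo `V`. -/
noncomputable def cod (V U : Submodule F (Fin b → F)) : ℕ :=
  finrank F U - finrank F ↥(V ⊓ U)

lemma cod_add_finrank_inf (V U : Submodule F (Fin b → F)) :
    cod V U + finrank F ↥(V ⊓ U) = finrank F U :=
  Nat.sub_add_cancel (Submodule.finrank_mono inf_le_right)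

lemma cod_add_finrank (V U : Submodule F (Fin b → F)) :
    cod V U + finrank F V = finrank F ↥(V ⊔ U) := by
  have h1 := cod_add_finrank_inf V U
  have h2 := Submodule.finrank_sup_add_finrank_inf_eq V U
  omega

lemma cod_le (V U : Submodule F (Fin b → F)) : cod V U ≤ finrank F U := Nat.sub_le _ _

lemma cod_submodular (V U U' : Submodule F (Fin b → F)) :
    cod V (U ⊔ U') + cod V (U ⊓ U') ≤ cod V U + cod V U' := by
  have h1 := cod_add_finrank V U
  have h2 := cod_add_finrank V U'
  have h3 := cod_add_finrank V (U ⊔ U')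
  have h4 := cod_add_finrank V (U ⊓ U')
  have h5 := Submodule.finrank_sup_add_finrank_inf_eq (V ⊔ U) (V ⊔ U')
  have h6 : finrank F ↥(V ⊔ (U ⊓ U')) ≤ finrank F ↥((V ⊔ U) ⊓ (V ⊔ U')) :=
    Submodule.finrank_mono sup_inf_le
  have h7 : (V ⊔ U) ⊔ (V ⊔ U') = V ⊔ (U ⊔ U') := by
    rw [sup_sup_sup_comm, sup_idem]
  rw [h7] at h5
  omega

lemma finrank_map_eq_cod {A : Matrix (Fin b) (Fin b) F} {V : Submodule F (Fin b → F)}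
    (hA : LinearMap.ker A.mulVecLin = V) (U : Submodule F (Fin b → F)) :
    finrank F (U.map A.mulVecLin) = cod V U := by
  have h1 := LinearMap.finrank_range_add_finrank_ker (A.mulVecLin.domRestrict U)
  rw [LinearMap.range_domRestrict] at h1
  have h2 : (LinearMap.ker (A.mulVecLin.domRestrict U)).map U.subtype = V ⊓ U := by
    rw [← hA]
    ext v
    constructor
    · rintro ⟨u, hu, rfl⟩
      exact ⟨hu, u.2⟩
    · rintro ⟨hv, hu⟩
      exact ⟨⟨v, hu⟩, hv, rfl⟩
  have h3 := cod_add_finrank_inf V U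
  rw [← h2, ← LinearEquiv.finrank_eq (Submodule.equivMapOfInjective _ U.injective_subtype _)] at h3
  omega

lemma exists_matrix_ker_eq (V : Submodule F (Fin b → F)) :
    ∃ A : Matrix (Fin b) (Fin b) F, LinearMap.ker A.mulVecLin = V := by
  obtain ⟨g, hg⟩ := V.mkQ.exists_rightInverse_of_surjective V.range_mkQ
  have hinj : LinearMap.ker g = ⊥ := LinearMap.ker_eq_bot_of_inverse hg
  refine ⟨LinearMap.toMatrix' (g ∘ₗ V.mkQ), ?_⟩
  rw [← Matrix.toLin'_apply', Matrix.toLin'_toMatrix', LinearMap.ker_comp, hinj,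
    ← LinearMap.ker, Submodule.ker_mkQ]

/-- The profile `V` has slope at least `κ` on every subspace. -/
def SlopeGE (V : LocalProfile F n b) (κ : ℕ) : Prop :=
  ∀ U : Submodule F (Fin b → F), κ * finrank F U ≤ ∑ i, cod (V i) U

/-- If the total codimension is larger than the slope requires, then one of the subspaces can be
enlarged. -/
lemma SlopeGE.exists_enlarge {V : LocalProfile F n b} {κ : ℕ} (h : SlopeGE V κ)
    (hlt : κ * b < ∑ i, cod (V i) ⊤) :
    ∃ V' : LocalProfile F n b, (∀ i, V i ≤ V' i) ∧ SlopeGE V' κ ∧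
      ∑ i, cod (V' i) ⊤ < ∑ i, cod (V i) ⊤ := by
  classical
  let tight : Set (Submodule F (Fin b → F)) := {U | ∑ i, cod (V i) U = κ * finrank F U}
  have htbot : (⊥ : Submodule F (Fin b → F)) ∈ tight := by
    have : ∀ i, cod (V i) ⊥ = 0 := fun i => Nat.le_zero.1 ((cod_le _ _).trans (by simp))
    simp [tight, this]
  -- Submodularity closes the tight subspaces under sums, so there is a largest one, `T`.
  have htsup : ∀ U ∈ tight, ∀ U' ∈ tight, U ⊔ U' ∈ tight := by
    intro U hU U' hU'
    have h1 : ∑ i, cod (V i) (U ⊔ U') + ∑ i, cod (V i) (U ⊓ U') ≤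
        ∑ i, cod (V i) U + ∑ i, cod (V i) U' := by
      rw [← Finset.sum_add_distrib, ← Finset.sum_add_distrib]
      exact Finset.sum_le_sum fun i _ => cod_submodular _ _ _
    have h2 := h (U ⊔ U')
    have h3 := h (U ⊓ U')
    have h4 := Submodule.finrank_sup_add_finrank_inf_eq U U'
    change _ = _ at hU hU' ⊢
    have h5 : κ * finrank F ↥(U ⊔ U') + κ * finrank F ↥(U ⊓ U') =
        κ * finrank F U + κ * finrank F U' := by rw [← mul_add, ← mul_add, h4]
    omega
  obtain ⟨T, hT, hTmax⟩ := (wellFounded_gt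
    (α := Submodule F (Fin b → F))).has_min tight ⟨⊥, htbot⟩
  have hTle : ∀ U ∈ tight, U ≤ T := by
    intro U hU
    by_contra hle
    exact hTmax _ (htsup U hU T hT) (right_lt_sup.2 hle)
  -- Otherwise `T` would have the total codimension of the whole space, more than `κ * b`, and could
  -- not be tight.
  obtain ⟨i, hi⟩ : ∃ i, V i ⊔ T ≠ ⊤ := by
    by_contra! hall
    have : ∑ i, cod (V i) T = ∑ i, cod (V i) ⊤ := by
      refine Finset.sum_congr rfl fun i _ => ?_
      have h1 := cod_add_finrank (V i) T
      have h2 := cod_add_finrank (V i) ⊤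
      rw [hall i] at h1
      rw [sup_top_eq] at h2
      omega
    change _ = _ at hT
    have hTb : finrank F T ≤ b := by simpa using Submodule.finrank_le T
    have := Nat.mul_le_mul_left κ hTb
    omega
  obtain ⟨v, -, hv⟩ := SetLike.exists_of_lt (lt_top_iff_ne_top.2 hi)
  set V' : LocalProfile F n b := Function.update V i (V i ⊔ Submodule.span F {v}) with hV'
  have hfin : finrank F ↥(V i ⊔ Submodule.span F {v}) = finrank F (V i) + 1 :=
    Submodule.finrank_sup_span_singleton fun hmem => hv ((le_sup_left : V i ≤ V i ⊔ T) hmem)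
  have hsum : ∀ (P : LocalProfile F n b) U, ∑ j, cod (P j) U =
      cod (P i) U + ∑ j ∈ Finset.univ.erase i, cod (P j) U := fun P U =>
    (Finset.add_sum_erase _ _ (Finset.mem_univ i)).symm
  have hrest : ∀ U, ∑ j ∈ Finset.univ.erase i, cod (V' j) U =
      ∑ j ∈ Finset.univ.erase i, cod (V j) U := fun U =>
    Finset.sum_congr rfl fun j hj => by
      rw [hV', Function.update_of_ne (Finset.ne_of_mem_erase hj)]
  have hi' : V' i = V i ⊔ Submodule.span F {v} := Function.update_self _ _ _
  refine ⟨V', fun j => ?_, fun U => ?_, ?_⟩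
  · by_cases hj : j = i
    · subst hj; rw [hi']; exact le_sup_left
    · rw [hV', Function.update_of_ne hj]
  · have h0 := h U
    have h1 := cod_add_finrank (V i) U
    have h2 := cod_add_finrank (V' i) U
    rw [hsum] at h0 ⊢
    rw [hrest]
    rw [hi', hfin] at h2
    rw [hi']
    -- A tight `U` lies in `T`, so `v ∉ V i ⊔ U` and its codimension is unchanged. For any other `U`
    -- it drops by at most one, which the strict inequality allows.
    by_cases hU : U ∈ tight
    · have hvU : v ∉ V i ⊔ U := fun hmem => hv (sup_le_sup_left (hTle U hU) _ hmem)
      have h3 : finrank F ↥(V i ⊔ Submodule.span F {v} ⊔ U) = finrank F ↥(V i ⊔ U) + 1 := by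
        rw [sup_right_comm]
        exact Submodule.finrank_sup_span_singleton hvU
      omega
    · have h3 : finrank F ↥(V i ⊔ U) ≤ finrank F ↥(V i ⊔ Submodule.span F {v} ⊔ U) :=
        Submodule.finrank_mono (sup_le_sup_right le_sup_left _)
      have h4 : ∑ j, cod (V j) U ≠ κ * finrank F U := hU
      rw [hsum] at h4
      omega
  · have h1 := cod_add_finrank (V i) ⊤
    have h2 := cod_add_finrank (V' i) ⊤
    rw [hsum, hsum V, hrest]
    rw [hi', hfin] at h2
    rw [hi']
    rw [sup_top_eq] at h1 h2
    omega

lemma SlopeGE.exists_tight {κ : ℕ} (m : ℕ) : ∀ V : LocalProfile F n b, SlopeGE V κ →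
    ∑ i, cod (V i) ⊤ ≤ m → ∃ V' : LocalProfile F n b, (∀ i, V i ≤ V' i) ∧ SlopeGE V' κ ∧
      ∑ i, cod (V' i) ⊤ ≤ κ * b := by
  induction m with
  | zero => exact fun V h hm => ⟨V, fun _ => le_rfl, h, hm.trans (Nat.zero_le _)⟩
  | succ m ih =>
    intro V h hm
    by_cases hle : ∑ i, cod (V i) ⊤ ≤ κ * b
    · exact ⟨V, fun _ => le_rfl, h, hle⟩
    · obtain ⟨V₁, h1, h2, h3⟩ := h.exists_enlarge (not_le.1 hle)
      obtain ⟨V', h4, h5⟩ := ih V₁ h2 (by omega)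
      exact ⟨V', fun i => (h1 i).trans (h4 i), h5⟩

/-- A profile of large slope can be relaxed to several profiles of smaller slope that constrain
disjoint sets of coordinates. -/
theorem SlopeGE.exists_disjoint {κ' : ℕ} (l : ℕ) : ∀ (V : LocalProfile F n b) (κ : ℕ),
    SlopeGE V κ → κ' + l * (κ' * b) ≤ κ →
    ∃ P : Fin (l + 1) → LocalProfile F n b, (∀ a i, V i ≤ P a i) ∧ (∀ a, SlopeGE (P a) κ') ∧
      ∀ a a' i, a ≠ a' → P a i = ⊤ ∨ P a' i = ⊤ := by
  classical
  induction l with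
  | zero =>
    intro V κ h hκ
    refine ⟨fun _ => V, fun _ _ => le_rfl, fun _ U => ?_, fun a a' i ha => ?_⟩
    · exact (Nat.mul_le_mul_right _ (by omega)).trans (h U)
    · exact absurd (Fin.ext (by omega)) ha
  | succ l ih =>
    intro V κ h hκ
    rw [add_mul, one_mul] at hκ
    have hV : SlopeGE V κ' := fun U => (Nat.mul_le_mul_right _ (by omega)).trans (h U)
    obtain ⟨V', h1, h2, h3⟩ := SlopeGE.exists_tight _ V hV le_rfl
    -- At most `κ' * b` coordinates of `V'` are proper, since each has codimension at least `1`.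
    -- Freeing them in `V` loses at most `κ' * b` of slope, and `V''` then constrains only the other
    -- coordinates.
    let V'' : LocalProfile F n b := fun i => if V' i = ⊤ then V i else ⊤
    have hV'' : SlopeGE V'' (κ - κ' * b) := by
      intro U
      have hterm : ∀ i, cod (V i) U ≤ cod (V'' i) U + cod (V' i) ⊤ * finrank F U := by
        intro i
        by_cases hi : V' i = ⊤
        · simp [V'', hi]
        · have hpos : 1 ≤ cod (V' i) ⊤ := by
            have h4 := cod_add_finrank (V' i) ⊤
            rw [sup_top_eq] at h4
            have h5 := Submodule.finrank_lt_finrank_of_lt (lt_top_iff_ne_top.2 hi)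
            omega
          have h6 := Nat.mul_le_mul_right (finrank F U) hpos
          have h7 := cod_le (V i) U
          omega
      have hs := Finset.sum_le_sum fun i (_ : i ∈ Finset.univ) => hterm i
      rw [Finset.sum_add_distrib, ← Finset.sum_mul] at hs
      have h8 := Nat.mul_le_mul_right (finrank F U) h3
      have h9 := h U
      rw [Nat.sub_mul]
      omega
    obtain ⟨P, hP1, hP2, hP3⟩ := ih V'' (κ - κ' * b) hV'' (by omega)
    have hle : ∀ i, V i ≤ V'' i := fun i => by
      by_cases hi : V' i = ⊤ <;> simp [V'', hi]
    have hdisj : ∀ a i, V' i = ⊤ ∨ P a i = ⊤ := by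
      intro a i
      by_cases hi : V' i = ⊤
      · exact Or.inl hi
      · right
        have := hP1 a i
        simpa [V'', hi] using this
    refine ⟨Fin.cons V' P, ?_, ?_, ?_⟩
    · intro a i
      refine Fin.cases ?_ (fun a => ?_) a
      · simpa using h1 i
      · simpa using (hle i).trans (hP1 a i)
    · intro a
      refine Fin.cases ?_ (fun a => ?_) a
      · simpa using h2
      · simpa using hP2 a
    · intro a a' i
      refine Fin.cases ?_ (fun a => ?_) a <;> refine Fin.cases ?_ (fun a' => ?_) a'
      · simp
      · intro _
        simpa using hdisj a' i
      · intro _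
        simpa using (hdisj a i).symm
      · intro hne
        simpa using hP3 a a' i (fun h => hne (by rw [h]))

end RSProfile

/-! ### From codes to bad points, and from bad points to probability. -/

namespace RSProfile

open Polynomial Module

lemma exists_polynomials_of_containsNonzero {F : Type*} [Field F] {n b : ℕ}
    {V : LocalProfile F n b} {α : Fin n → F} {k : ℕ}
    (h : ContainsNonzero (rsCode α k) V) :
    ∃ f : Fin b → F[X], f ≠ 0 ∧ f ∈ degVec F b k ∧ ∀ i, evalVec b (α i) f ∈ V i := by
  obtain ⟨M, hM0, hMV, hMC⟩ := h
  choose f hf hfM using hMC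
  refine ⟨f, fun h0 => hM0 ?_, mem_degVec.2 hf, fun i => ?_⟩
  · ext i j
    have := hfM j i
    simpa [h0] using this
  · convert hMV i using 1
    funext j
    exact (hfM j i).symm

lemma containsNonzero_of_containsProfile {F : Type*} [Field F] {n b : ℕ}
    {V : LocalProfile F n b} (hb : 2 ≤ b)
    {C : Set (Fin n → F)} (h : ContainsProfile C V) : ContainsNonzero C V := by
  obtain ⟨M, hinj, hMV, hMC⟩ := h
  refine ⟨M, fun h0 => ?_, hMV, hMC⟩
  have : (⟨0, by omega⟩ : Fin b) = ⟨1, by omega⟩ := hinj (by rw [h0]; rfl)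
  simp at this

section

variable {F : Type*} [Field F] [Fintype F] {n b : ℕ}

-- The bad sets of the `l + 1` disjoint profiles are merged. At each coordinate at most one of them
-- is nonempty, so the size bound is not multiplied by `l + 1`, while the counts of bad coordinates
-- add up.
open Classical in
theorem SlopeGE.exists_bad_points {V : LocalProfile F n b} {k t l κ κ' : ℕ} (hV : SlopeGE V κ)
    (hκ : κ' + l * (κ' * b) ≤ κ) (hκ' : k + t + b ^ 2 ≤ κ') :
    ∃ bad : Fin n → (Fin n → F) → Finset F,
      (∀ i α α', (∀ j < i, α j = α' j) → bad i α = bad i α') ∧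
      (∀ i α, (bad i α).card ≤ b * (b * (k + t + b ^ 3 + b))) ∧
      ∀ α f, f ≠ 0 → f ∈ degVec F b k → (∀ i, evalVec b (α i) f ∈ V i) →
        (l + 1) * t ≤ (Finset.univ.filter fun i => α i ∈ bad i α).card := by
  obtain ⟨P, hle, hslope, hdisj⟩ := SlopeGE.exists_disjoint l V κ hV hκ
  choose A hA using fun a i => exists_matrix_ker_eq (P a i)
  have hA0 : ∀ a i, P a i = ⊤ → A a i = 0 := fun a i h => by
    have := hA a i
    rw [h, LinearMap.ker_eq_top, ← Matrix.mulVecLin_zero] at this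
    exact Matrix.mulVec_injective (funext fun v => LinearMap.congr_fun this v)
  choose bad hpred hcard hzero hcount using fun a =>
    RSProfile.exists_bad_points (A a) hκ' fun U => by
      simp only [finrank_map_eq_cod (hA a _)]
      exact hslope a U
  have hdis : ∀ i α a a', a ≠ a' → bad a i α = ∅ ∨ bad a' i α = ∅ := fun i α a a' h =>
    (hdisj a a' i h).imp (fun h => hzero _ _ _ (hA0 _ _ h)) (fun h => hzero _ _ _ (hA0 _ _ h))
  refine ⟨fun i α => Finset.univ.biUnion fun a => bad a i α, fun i α α' h => ?_,
    fun i α => ?_, fun α f hf0 hfd hf => ?_⟩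
  · exact Finset.biUnion_congr rfl fun a _ => hpred a i α α' h
  · by_cases hex : ∃ a, bad a i α ≠ ∅
    · obtain ⟨a, ha⟩ := hex
      refine le_trans (Finset.card_le_card fun x hx => ?_) (hcard a i α)
      obtain ⟨a', -, hx⟩ := Finset.mem_biUnion.1 hx
      by_cases haa : a = a'
      · rwa [haa]
      · rw [(hdis i α a a' haa).resolve_left ha] at hx
        simp at hx
    · push Not at hex
      refine (Finset.card_eq_zero.2 (Finset.eq_empty_of_forall_notMem fun x hx => ?_)).trans_le
        (Nat.zero_le _)
      obtain ⟨a, -, hx⟩ := Finset.mem_biUnion.1 hx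
      simp [hex] at hx
  · have hsub : (Finset.univ.biUnion fun a =>
        Finset.univ.filter fun i => α i ∈ bad a i α) ⊆
        Finset.univ.filter fun i => α i ∈ Finset.univ.biUnion fun a => bad a i α := by
      intro i hi
      obtain ⟨a, -, hi⟩ := Finset.mem_biUnion.1 hi
      exact Finset.mem_filter.2 ⟨Finset.mem_univ _,
        Finset.mem_biUnion.2 ⟨a, Finset.mem_univ _, (Finset.mem_filter.1 hi).2⟩⟩
    refine le_trans ?_ (Finset.card_le_card hsub)
    rw [Finset.card_biUnion]
    · have : ∀ a ∈ Finset.univ, t ≤ (Finset.univ.filter fun i => α i ∈ bad a i α).card := by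
        intro a _
        refine hcount a α f hf0 hfd fun i => ?_
        have hmem := hle a i (hf i)
        rw [← hA a i] at hmem
        exact hmem
      simpa using Finset.card_nsmul_le_sum _ _ _ this
    · intro a _ a' _ hne
      rw [Function.onFun, Finset.disjoint_left]
      intro i hi hi'
      simp only [Finset.mem_filter, Finset.mem_univ, true_and] at hi hi'
      rcases hdis i α a a' hne with h | h
      · rw [h] at hi; simp at hi
      · rw [h] at hi'; simp at hi'

lemma pointsProb_eq (E : Set (Fin n → F)) [Fintype E] :
    pointsProb E = Fintype.card E / (Fintype.card F : ℝ) ^ n := by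
  unfold pointsProb
  rw [PMF.toOuterMeasure_uniformOfFintype_apply]
  simp

lemma pointsProb_mono {E E' : Set (Fin n → F)} (h : E ⊆ E') : pointsProb E ≤ pointsProb E' := by
  classical
  rw [pointsProb_eq, pointsProb_eq]
  gcongr
  exact Set.card_le_card h

open Classical in
lemma pointsProb_le_of_bad (E : Set (Fin n → F)) (D t : ℕ)
    (bad : Fin n → (Fin n → F) → Finset F)
    (hpred : ∀ i α α', (∀ j < i, α j = α' j) → bad i α = bad i α')
    (hD : ∀ i α, (bad i α).card ≤ D)
    (hE : ∀ α ∈ E, t ≤ (Finset.univ.filter fun i => α i ∈ bad i α).card) :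
    pointsProb E ≤ n.choose t * ((D : ℝ) / Fintype.card F) ^ t := by
  have hq : (0 : ℝ) < Fintype.card F := by exact_mod_cast Fintype.card_pos
  have h1 := card_bad_coordinates_le D n t bad hpred hD
  have h2 : Fintype.card E ≤ (Finset.univ.filter fun α : Fin n → F =>
      t ≤ (Finset.univ.filter fun i => α i ∈ bad i α).card).card := by
    rw [← Set.toFinset_card]
    refine Finset.card_le_card fun α hα => ?_
    exact Finset.mem_filter.2 ⟨Finset.mem_univ _, hE α (Set.mem_toFinset.1 hα)⟩
  have h3 : (Fintype.card E : ℝ) * (Fintype.card F : ℝ) ^ t ≤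
      n.choose t * (D : ℝ) ^ t * (Fintype.card F : ℝ) ^ n := by
    exact_mod_cast (Nat.mul_le_mul_right _ h2).trans h1
  rw [pointsProb_eq, div_pow, div_le_iff₀ (by positivity), mul_div_assoc', div_mul_eq_mul_div,
    le_div_iff₀ (by positivity)]
  exact h3

lemma slopeGE_of_minRate (V : LocalProfile F n b) {R ε : ℝ} {k : ℕ}
    (hn : 0 < n) (hR : R ≤ minRate V - ε) (hk : (k : ℝ) = R * n) {e : ℕ} (he : (e : ℝ) ≤ ε * n) :
    SlopeGE V (k + e) := by
  intro U
  by_cases hU : U = ⊥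
  · rw [hU, finrank_bot, mul_zero]
    exact Nat.zero_le _
  have hbdd : BddBelow (Set.range fun U : {U : Submodule F (Fin b → F) // U ≠ ⊥} =>
      (∑ i, ((finrank F U.1 : ℝ) - (finrank F ↥(V i ⊓ U.1) : ℝ))) /
        ((finrank F U.1 : ℝ) * n)) := (Set.finite_range _).bddBelow
  have h1 : minRate V ≤ _ := ciInf_le hbdd ⟨U, hU⟩
  have hdim : (0 : ℝ) < finrank F U := by
    have : finrank F U ≠ 0 := fun h => hU (Submodule.finrank_eq_zero.1 h)
    exact_mod_cast Nat.pos_of_ne_zero this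
  have hn' : (0 : ℝ) < n := by exact_mod_cast hn
  have hsum : ∑ i, ((finrank F U : ℝ) - (finrank F ↥(V i ⊓ U) : ℝ)) =
      ((∑ i, cod (V i) U : ℕ) : ℝ) := by
    push_cast
    refine Finset.sum_congr rfl fun i _ => ?_
    rw [← cod_add_finrank_inf (V i) U]
    push_cast
    ring
  simp only [hsum] at h1
  have h2 : R + ε ≤ ((∑ i, cod (V i) U : ℕ) : ℝ) / ((finrank F U : ℝ) * n) := by linarith
  rw [le_div_iff₀ (by positivity)] at h2
  have h3 : (((k + e) * finrank F U : ℕ) : ℝ) ≤ ((∑ i, cod (V i) U : ℕ) : ℝ) := by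
    push_cast at h2 ⊢
    rw [hk]
    have := mul_le_mul_of_nonneg_right he hdim.le
    linarith
  exact_mod_cast h3

end

/-! ### Numerical estimates and conclusion. -/

lemma choose_le_exp_mul_div_pow (n : ℕ) {t : ℕ} (ht : 0 < t) :
    (n.choose t : ℝ) ≤ (Real.exp 1 * n / t) ^ t := by
  have ht' : (0 : ℝ) < t := by exact_mod_cast ht
  have h1 : (n.choose t : ℝ) ≤ (n : ℝ) ^ t / t.factorial := Nat.choose_le_pow_div t n
  have h2 : (t : ℝ) ^ t / t.factorial ≤ Real.exp t := Real.pow_div_factorial_le_exp _ ht'.le t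
  have h3 : Real.exp t = Real.exp 1 ^ t := by rw [← Real.exp_nat_mul, mul_one]
  rw [h3] at h2
  refine h1.trans ?_
  rw [div_pow, mul_pow, le_div_iff₀ (by positivity)]
  calc (n : ℝ) ^ t / t.factorial * t ^ t = (t : ℝ) ^ t / t.factorial * n ^ t := by ring
    _ ≤ Real.exp 1 ^ t * n ^ t := by gcongr

/-- By `C(n,t) ≤ (e n / t)^t`, `e ≤ 3` and `n / t ≤ 2b / ε`, the base is at most `6bD / (ε q)`. As
`c / (ε q) ≤ 1`, the exponent `t` may be lowered to `ε n / (2b)`. -/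
lemma choose_mul_pow_le {n b t D : ℕ} {ε q c : ℝ} (hb : 1 ≤ b) (ht : 0 < t) (hε : 0 < ε)
    (hq : 0 < q) (hn : ε * n ≤ 2 * b * t) (hD : 6 * (b : ℝ) * D ≤ c) (hc : 0 < c)
    (hlt : c / (ε * q) ≤ 1) :
    (n.choose t : ℝ) * (D / q) ^ t ≤ (c / (ε * q)) ^ (ε * n / (2 * b)) := by
  have ht' : (0 : ℝ) < t := by exact_mod_cast ht
  have hb' : (0 : ℝ) < b := by exact_mod_cast hb
  have hbase : Real.exp 1 * n / t * (D / q) ≤ c / (ε * q) := by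
    have he : Real.exp 1 ≤ 3 := by linarith [Real.exp_one_lt_d9]
    have h1 : (n : ℝ) / t ≤ 2 * b / ε := by
      rw [div_le_div_iff₀ ht' hε]; linarith
    calc Real.exp 1 * n / t * (D / q) = Real.exp 1 * (n / t) * (D / q) := by ring
      _ ≤ 3 * (2 * b / ε) * (D / q) := by gcongr
      _ = (6 * b * D) / (ε * q) := by field_simp; ring
      _ ≤ c / (ε * q) := by gcongr
  calc (n.choose t : ℝ) * (D / q) ^ t
      ≤ (Real.exp 1 * n / t) ^ t * (D / q) ^ t := by
        gcongr
        exact choose_le_exp_mul_div_pow n ht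
    _ = (Real.exp 1 * n / t * (D / q)) ^ t := (mul_pow _ _ _).symm
    _ ≤ (c / (ε * q)) ^ t := by gcongr
    _ = (c / (ε * q)) ^ (t : ℝ) := (Real.rpow_natCast _ _).symm
    _ ≤ (c / (ε * q)) ^ (ε * n / (2 * b)) := by
        apply Real.rpow_le_rpow_of_exponent_ge (by positivity) hlt
        rw [div_le_iff₀ (by positivity)]
        linarith

/-- Here `e` is the integer part of `ε n`. The number `(l + 1) * t` of forced bad points must exceed
`e / (2b)`, while `t = O(b² k)` keeps the number of bad values per point linear in `k`. -/
lemma exists_parameters {b k e : ℕ} (hb : 1 ≤ b) (hk : 1 ≤ k) (he : 2 * b * (b + 1) ≤ e) :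
    ∃ t l κ' : ℕ, k + t + b ^ 2 ≤ κ' ∧ κ' + l * (κ' * b) ≤ k + e ∧
      e + 1 ≤ 2 * b * ((l + 1) * t) ∧ t ≤ 10 * b ^ 2 * k := by
  have hbk : b ^ 2 ≤ b ^ 2 * k := Nat.le_mul_of_pos_right _ hk
  have hkb : k ≤ b ^ 2 * k := Nat.le_mul_of_pos_left _ (by positivity)
  by_cases hcase : e + 1 ≤ 20 * b ^ 3 * k
  -- For small `e` one profile suffices, with `t = ⌊e / (2b)⌋ + 1`.
  · have hdiv := Nat.div_add_mod (e + 2 * b) (2 * b)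
    have hmod := Nat.mod_lt (e + 2 * b) (show 0 < 2 * b by omega)
    set t := (e + 2 * b) / (2 * b) with ht
    refine ⟨t, 0, k + t + b ^ 2, le_rfl, ?_, ?_, ?_⟩
    · by_contra hlt
      have h1 : e + 1 ≤ t + b ^ 2 := by omega
      have h2 : 2 * b * (e + 1) ≤ 2 * b * (t + b ^ 2) := Nat.mul_le_mul_left _ h1
      have h3 : 2 * b * t ≤ e + 2 * b := by omega
      have h4 : 0 < b ^ 2 := by positivity
      have h5 : b * (2 * b * (b + 1)) ≤ b * e := Nat.mul_le_mul_left b he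
      have h6 : 1 * e ≤ b * e := Nat.mul_le_mul_right e hb
      linarith
    · rw [zero_add, one_mul]; omega
    · by_contra hlt
      have h2 : 2 * b * (10 * b ^ 2 * k + 1) ≤ 2 * b * t := Nat.mul_le_mul_left _ (by omega)
      have h3 : 2 * b * (10 * b ^ 2 * k + 1) = 20 * b ^ 3 * k + 2 * b := by ring
      omega
  -- For large `e`, `t` is fixed and `l` is as large as the slope allows. The three parts of the
  -- bound on `e + 1` are `3 + 2 + 5 = 10` multiples of `(l + 1) b³ k`; the first uses `l ≥ 1`.
  · set t := 5 * b ^ 2 * k with ht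
    set κ' := k + t + b ^ 2 with hκ'
    have hκle : κ' ≤ 7 * (b ^ 2 * k) := by
      rw [hκ', ht]; linarith
    have hpos : 0 < κ' * b := Nat.mul_pos (by omega) hb
    have hbig : κ' + κ' * b ≤ k + e := by
      have h1 : κ' * (1 + b) ≤ 7 * (b ^ 2 * k) * (2 * b) := Nat.mul_le_mul hκle (by omega)
      have h2 : 7 * (b ^ 2 * k) * (2 * b) = 14 * (b ^ 3 * k) := by ring
      have h3 : 20 * b ^ 3 * k = 20 * (b ^ 3 * k) := by ring
      rw [mul_add, mul_one] at h1
      omega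
    have hdiv := Nat.div_add_mod (k + e - κ') (κ' * b)
    have hmod := Nat.mod_lt (k + e - κ') hpos
    have hl : 1 ≤ (k + e - κ') / (κ' * b) := (Nat.one_le_div_iff hpos).2 (by omega)
    set l := (k + e - κ') / (κ' * b) with hldef
    refine ⟨t, l, κ', le_rfl, ?_, ?_, by rw [ht]; gcongr; norm_num⟩
    · rw [mul_comm l]; omega
    · have h1 : k + e + 1 ≤ κ' + (l + 1) * (κ' * b) := by
        rw [add_mul, one_mul, mul_comm l]; omega
      have h2 : t + b ^ 2 ≤ 3 * ((l + 1) * (b ^ 3 * k)) := by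
        have h3 : 2 * (b ^ 2 * k) ≤ (l + 1) * (b ^ 3 * k) := by
          refine Nat.mul_le_mul (by omega) (Nat.mul_le_mul_right _ ?_)
          exact Nat.pow_le_pow_right hb (by norm_num)
        rw [ht]; linarith
      have h4 : (l + 1) * ((k + b ^ 2) * b) ≤ 2 * ((l + 1) * (b ^ 3 * k)) := by
        have h5 : (k + b ^ 2) * b ≤ 2 * (b ^ 2 * k) * b := Nat.mul_le_mul_right _ (by omega)
        calc _ ≤ (l + 1) * (2 * (b ^ 2 * k) * b) := Nat.mul_le_mul_left _ h5
          _ = _ := by ring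
      have h6 : (l + 1) * (κ' * b) = (l + 1) * ((k + b ^ 2) * b) + 5 * ((l + 1) * (b ^ 3 * k)) := by
        rw [hκ', ht]; ring
      have h7 : 2 * b * ((l + 1) * t) = 10 * ((l + 1) * (b ^ 3 * k)) := by
        rw [ht]; ring
      omega

lemma six_mul_le_pow {b k t : ℕ} (hb : 1 ≤ b) (hk : 1 ≤ k) (ht : t ≤ 10 * b ^ 2 * k) :
    6 * b * (b * (b * (k + t + b ^ 3 + b))) ≤ (4 * b) ^ (4 * b) * k := by
  have h1 : k + t + b ^ 3 + b ≤ 13 * b ^ 3 * k := by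
    have e1 : k ≤ b ^ 3 * k := Nat.le_mul_of_pos_left _ (by positivity)
    have e2 : b ^ 2 * k ≤ b ^ 3 * k :=
      Nat.mul_le_mul_right _ (Nat.pow_le_pow_right hb (by norm_num))
    have e3 : b ^ 3 ≤ b ^ 3 * k := Nat.le_mul_of_pos_right _ hk
    have e4 : b ≤ b ^ 3 := Nat.le_self_pow (by norm_num) b
    nlinarith
  have h2 : 78 * b ^ 6 ≤ (4 * b) ^ (4 * b) := by
    rcases Nat.eq_or_lt_of_le hb with rfl | hb2
    · norm_num
    · calc 78 * b ^ 6 ≤ 4096 * b ^ 6 := by gcongr; norm_num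
        _ = (4 * b) ^ 6 := by ring
        _ ≤ (4 * b) ^ (4 * b) := Nat.pow_le_pow_right (by omega) (by omega)
  calc 6 * b * (b * (b * (k + t + b ^ 3 + b))) ≤ 6 * b * (b * (b * (13 * b ^ 3 * k))) := by gcongr
    _ = 78 * b ^ 6 * k := by ring
    _ ≤ (4 * b) ^ (4 * b) * k := Nat.mul_le_mul_right _ h2

theorem pointsProb_containsNonzero_le {F : Type*} [Field F] [Fintype F] {n b k : ℕ} (hb : 1 ≤ b)
    (V : LocalProfile F n b) {R ε : ℝ} (hε : 0 < ε) (hR : R ≤ minRate V - ε)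
    (hk : (k : ℝ) = R * n) (hεn : 2 * (b : ℝ) * (b + 1) ≤ ε * n) :
    pointsProb {α : Fin n → F | ContainsNonzero (rsCode α k) V} ≤
      ((4 * (b : ℝ)) ^ (4 * b) * k / (ε * Fintype.card F)) ^ (ε * n / (2 * b)) := by
  classical
  have hq : (0 : ℝ) < Fintype.card F := by exact_mod_cast Fintype.card_pos
  have hb' : (0 : ℝ) < b := by exact_mod_cast hb
  -- For `k = 0` the code is zero and the event is empty.
  rcases Nat.eq_zero_or_pos k with rfl | hk1
  · have hempty : {α : Fin n → F | ContainsNonzero (rsCode α 0) V} = ∅ := by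
      ext α
      simp only [Set.mem_ofPred_eq, Set.mem_empty_iff_false, iff_false]
      intro h
      obtain ⟨f, hf0, hfd, -⟩ := exists_polynomials_of_containsNonzero h
      refine hf0 (funext fun i => ?_)
      simpa using mem_degVec.1 hfd i
    rw [hempty, pointsProb_eq]
    simp only [Fintype.card_of_isEmpty, Nat.cast_zero, zero_div]
    positivity
  set c : ℝ := (4 * (b : ℝ)) ^ (4 * b) * k with hc
  have hk1' : (0 : ℝ) < k := by exact_mod_cast hk1
  have hcpos : 0 < c := by positivity
  -- If the base exceeds `1`, the claimed bound does too and there is nothing to prove.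
  by_cases hlt : c / (ε * Fintype.card F) ≤ 1
  · have hn : 0 < n := by
      rcases Nat.eq_zero_or_pos n with rfl | hn
      · have : 0 < 2 * (b : ℝ) * (b + 1) := by positivity
        simp at hεn
        linarith
      · exact hn
    have hfl : (⌊ε * n⌋₊ : ℝ) ≤ ε * n := Nat.floor_le (by positivity)
    have hfl' : ε * n < ⌊ε * n⌋₊ + 1 := Nat.lt_floor_add_one _
    have he : 2 * b * (b + 1) ≤ ⌊ε * n⌋₊ := Nat.le_floor (by exact_mod_cast hεn)
    set e := ⌊ε * n⌋₊
    obtain ⟨t, l, κ', h1, h2, h3, h4⟩ := exists_parameters hb hk1 he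
    obtain ⟨bad, hpred, hcard, hcount⟩ :=
      (slopeGE_of_minRate V hn hR hk hfl).exists_bad_points h2 h1
    have hprob := pointsProb_le_of_bad {α : Fin n → F | ContainsNonzero (rsCode α k) V} _
      ((l + 1) * t) bad hpred hcard fun α hα => by
        obtain ⟨f, hf0, hfd, hfV⟩ := exists_polynomials_of_containsNonzero hα
        exact hcount α f hf0 hfd hfV
    refine hprob.trans (choose_mul_pow_le hb ?_ hε hq ?_ ?_ hcpos hlt)
    · by_contra h0
      rw [Nat.eq_zero_of_not_pos h0] at h3
      omega
    · have : ((e + 1 : ℕ) : ℝ) ≤ ((2 * b * ((l + 1) * t) : ℕ) : ℝ) := by exact_mod_cast h3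
      push_cast at this ⊢
      linarith
    · rw [hc]
      exact_mod_cast six_mul_le_pow hb hk1 h4
  · have hprob : pointsProb {α : Fin n → F | ContainsNonzero (rsCode α k) V} ≤ 1 := by
      rw [pointsProb_eq, div_le_one (by positivity)]
      have := set_fintype_card_le_univ {α : Fin n → F | ContainsNonzero (rsCode α k) V}
      simp only [Fintype.card_pi, Finset.prod_const, Finset.card_univ, Fintype.card_fin] at this
      exact_mod_cast this
    exact hprob.trans (Real.one_le_rpow (not_le.1 hlt).le (by positivity))

end RSProfile

theorem mainTheorem5 {F : Type*} [Field F] [Fintype F] (n b k : ℕ) (hb : 1 ≤ b)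
    (hnq : n ≤ Fintype.card F)
    (V : RSProfile.LocalProfile F n b) (R ε : ℝ) (hε : 0 < ε)
    (hR : R ≤ RSProfile.minRate V - ε) (hk : (k : ℝ) = R * n)
    (hq : k * b < Fintype.card F) (hεn : 2 * (b : ℝ) * (b + 1) ≤ ε * n) :
    (2 ≤ b →
      RSProfile.pointsProb {α : Fin n → F | RSProfile.ContainsProfile (RSProfile.rsCode α k) V} ≤
        ((4 * (b : ℝ)) ^ (4 * b) * k / (ε * Fintype.card F)) ^ (ε * n / (2 * b))) ∧
    RSProfile.pointsProb {α : Fin n → F | RSProfile.ContainsNonzero (RSProfile.rsCode α k) V} ≤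
      ((4 * (b : ℝ)) ^ (4 * b) * k / (ε * Fintype.card F)) ^ (ε * n / (2 * b)) := by
  have h := RSProfile.pointsProb_containsNonzero_le hb V hε hR hk hεn
  exact ⟨fun hb2 => (RSProfile.pointsProb_mono fun α hα =>
    RSProfile.containsNonzero_of_containsProfile hb2 hα).trans h, h⟩
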